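/- Let $1<p,q<\infty$ and $t_0>0$ be fixed. For $r>1$ and $x\in\mathbb{R}$ read $|x|^{r-2}x$ as $0$ when $x=0$. For $\lambda>0$ consider the problem \[ (|u''|^{p-2}u'')''=\lambda |u|^{q-2}u \quad\text{on } [0,t_0],\qquad u(0)=u(t_0)=u''(0)=u''(t_0)=0. \tag{$P_\lambda$} \] By a positive solution of $(P_\lambda)$ we mean a function $u\in C^2([0,t_0];\mathbb{R})$ such that $|u''|^{p-2}u''\in C^2([0,t_0])$, the equation holds at every $t\in[0,t_0]$ (with one-sided derivatives at the endpoints), the four boundary conditions hold, and $u(t)>0$ for all $t\in(0,t_0)$. (a) If $p\neq q$, then for every $\lambda>0$ the problem $(P_\lambda)$ has exactly one positive solution. (b) If $p=q$, then there is exactly one $\lambda=\lambda(t_0)>0$ for which $(P_\lambda)$ has a positive solution. For this $\lambda$ the positive solution is unique up to multiplication by constants: if $u$ is a positive solution, then the positive solutions are exactly the functions $cu$ with $c>0$. -/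

import Mathlib

open Set

noncomputable section

/-- The signed power `|x|^(r-2) x`. For `r > 1` its value at `x = 0` is `0`. -/
def signedPow (r x : ℝ) : ℝ := |x| ^ (r - 2) * x

/-- The function `|u''|^(p-2) u''` on `[0, t₀]` (one-sided derivatives at the endpoints). -/
def biharmonicFlux (p t₀ : ℝ) (u : ℝ → ℝ) (t : ℝ) : ℝ :=
  signedPow p (iteratedDerivWithin 2 u (Icc 0 t₀) t)

/-- `u` is a (classical) solution on `[0, t₀]` of
`(|u''|^(p-2) u'')'' = lam |u|^(q-2) u` with Navier boundary conditions
`u(0) = u(t₀) = u''(0) = u''(t₀) = 0`. Both `u` and `|u''|^(p-2) u''` are required to be of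
class `C²` on the closed interval. Only the values of `u` on `[0, t₀]` matter. -/
structure IsNavierSolution (p q lam t₀ : ℝ) (u : ℝ → ℝ) : Prop where
  contDiffOn : ContDiffOn ℝ 2 u (Icc 0 t₀)
  contDiffOn_flux : ContDiffOn ℝ 2 (biharmonicFlux p t₀ u) (Icc 0 t₀)
  equation : ∀ t ∈ Icc 0 t₀,
    iteratedDerivWithin 2 (biharmonicFlux p t₀ u) (Icc 0 t₀) t = lam * signedPow q (u t)
  left : u 0 = 0
  right : u t₀ = 0
  left_second : iteratedDerivWithin 2 u (Icc 0 t₀) 0 = 0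
  right_second : iteratedDerivWithin 2 u (Icc 0 t₀) t₀ = 0

/-- A solution which is positive on the open interval `(0, t₀)`. -/
structure IsPositiveNavierSolution (p q lam t₀ : ℝ) (u : ℝ → ℝ) : Prop
    extends IsNavierSolution p q lam t₀ u where
  pos : ∀ t ∈ Ioo 0 t₀, 0 < u t

end

/-! ### Monotonicity from one-sided derivatives -/

/-! Put `w = -|u''|^(p-2) u''`. The problem becomes the Lane–Emden system `-u'' = w^(1/(p-1))`,
`-w'' = lam * u^(q-1)` with `u` and `w` zero at both ends; concavity makes `w` positive inside as
soon as `u` is.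

Uniqueness is a shooting argument. Both nonlinearities are increasing, so for equal `u'(0)` the pair
with the larger `w'(0)` has the larger `w` and the smaller `u` afterwards (`lt_of_slope_lt`), which
is incompatible with both components vanishing at the end. If both slopes agree the pairs agree: the
powers need not be Lipschitz at `0`, but the components grow at least linearly there, so the
Lipschitz constants are only of order `1/t`, which a Gronwall argument absorbs
(`eq_zero_of_abs_deriv2_le`). Thus `u'(0)` determines the pair and its interval. Replacing `(u, w)`
by `(A u(μ t), B w(μ t))` adjusts both `u'(0)` and `lam`; comparing interval lengths then forces `μ
= 1`. Hence positive solutions for `lam` and `lam'` are always proportional, with a factor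
satisfying `A^(p-1) * lam' = lam * A^(q-1)`.

Existence for one parameter comes from maximising `∫ (G f)^q` over `f ≥ 0` with `∫ f^p ≤ 1`, where
`G` inverts `-d²/dt²` with Dirichlet conditions (`exists_dirichletSolution_fixed`). The relation
between `A` and the parameters finishes the proof: for `p ≠ q` it reaches every `lam` and leaves
only `A = 1` when `lam = lam'`; for `p = q` it forces `lam = lam'` and leaves `A` free. -/

lemma monotoneOn_Icc_of_hasDerivWithinAt {f f' : ℝ → ℝ} {x y : ℝ}
    (hf : ∀ t ∈ Icc x y, HasDerivWithinAt f (f' t) (Icc x y) t)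
    (h : ∀ t ∈ Ioo x y, 0 ≤ f' t) : MonotoneOn f (Icc x y) := by
  have hd : ∀ t ∈ interior (Icc x y), HasDerivAt f (f' t) t := fun t ht => by
    rw [interior_Icc] at ht
    exact (hf t (Ioo_subset_Icc_self ht)).hasDerivAt (Icc_mem_nhds ht.1 ht.2)
  refine monotoneOn_of_deriv_nonneg (convex_Icc x y)
    (fun t ht => (hf t ht).continuousWithinAt)
    (fun t ht => (hd t ht).differentiableAt.differentiableWithinAt) fun t ht => ?_
  rw [(hd t ht).deriv]
  exact h t (by rwa [interior_Icc] at ht)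

lemma strictMonoOn_Icc_of_hasDerivWithinAt {f f' : ℝ → ℝ} {x y : ℝ}
    (hf : ∀ t ∈ Icc x y, HasDerivWithinAt f (f' t) (Icc x y) t)
    (h : ∀ t ∈ Ioo x y, 0 < f' t) : StrictMonoOn f (Icc x y) := by
  refine strictMonoOn_of_deriv_pos (convex_Icc x y)
    (fun t ht => (hf t ht).continuousWithinAt) fun t ht => ?_
  rw [interior_Icc] at ht
  rw [((hf t (Ioo_subset_Icc_self ht)).hasDerivAt (Icc_mem_nhds ht.1 ht.2)).deriv]
  exact h t ht

/-- A function with negative second derivative and vanishing at both ends is positive inside. -/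
lemma pos_of_hasDerivWithinAt_neg {w w₁ w₂ : ℝ → ℝ} {T : ℝ}
    (hw : ∀ t ∈ Icc 0 T, HasDerivWithinAt w (w₁ t) (Icc 0 T) t)
    (hw₁ : ∀ t ∈ Icc 0 T, HasDerivWithinAt w₁ (w₂ t) (Icc 0 T) t)
    (h : ∀ t ∈ Ioo 0 T, w₂ t < 0) (h0 : w 0 = 0) (hT : w T = 0) {t : ℝ} (ht : t ∈ Ioo 0 T) :
    0 < w t := by
  have hanti : StrictMonoOn (fun s => -w₁ s) (Icc 0 T) :=
    strictMonoOn_Icc_of_hasDerivWithinAt (fun s hs => (hw₁ s hs).neg)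
      fun s hs => neg_pos.2 (h s hs)
  rcases le_or_gt 0 (w₁ t) with h1 | h1
  · have hsub : Icc 0 t ⊆ Icc 0 T := Icc_subset_Icc_right ht.2.le
    have := strictMonoOn_Icc_of_hasDerivWithinAt (fun s hs => (hw s (hsub hs)).mono hsub)
      (fun s hs => by
        have := hanti (hsub (Ioo_subset_Icc_self hs)) (Ioo_subset_Icc_self ht) hs.2
        simp only at this
        linarith)
    have := this (left_mem_Icc.2 ht.1.le) (right_mem_Icc.2 ht.1.le) ht.1
    linarith
  · have hsub : Icc t T ⊆ Icc 0 T := Icc_subset_Icc_left ht.1.le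
    have := strictMonoOn_Icc_of_hasDerivWithinAt (f := fun s => -w s)
      (fun s hs => ((hw s (hsub hs)).mono hsub).neg)
      (fun s hs => by
        have := hanti (Ioo_subset_Icc_self ht) (hsub (Ioo_subset_Icc_self hs)) hs.1
        simp only at this
        linarith)
    have := this (left_mem_Icc.2 ht.2.le) (right_mem_Icc.2 ht.2.le) ht.2
    simp only at this
    linarith

/-- A function with nonpositive second derivative lies above its chords from the origin. -/
lemma le_mul_of_hasDerivWithinAt_nonpos {u u₁ u₂ : ℝ → ℝ} {T : ℝ}
    (hu : ∀ t ∈ Icc 0 T, HasDerivWithinAt u (u₁ t) (Icc 0 T) t)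
    (hu₁ : ∀ t ∈ Icc 0 T, HasDerivWithinAt u₁ (u₂ t) (Icc 0 T) t)
    (h : ∀ t ∈ Ioo 0 T, u₂ t ≤ 0) (h0 : u 0 = 0) {t : ℝ} (ht : t ∈ Icc 0 T) :
    t * u T ≤ T * u t := by
  have hanti : MonotoneOn (fun s => -u₁ s) (Icc 0 T) :=
    monotoneOn_Icc_of_hasDerivWithinAt (fun s hs => (hu₁ s hs).neg)
      fun s hs => neg_nonneg.2 (h s hs)
  have hsub : Icc 0 t ⊆ Icc 0 T := Icc_subset_Icc_right ht.2
  have hsub' : Icc t T ⊆ Icc 0 T := Icc_subset_Icc_left ht.1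
  -- Both ends lie below the tangent at `t`. Weighting the two inequalities by `T - t` and `t`
  -- eliminates the slope `u₁ t`.
  have h1 := monotoneOn_Icc_of_hasDerivWithinAt (f := fun s => u s - u₁ t * s)
    (fun s hs => ((hu s (hsub hs)).mono hsub).sub ((hasDerivWithinAt_id s _).const_mul (u₁ t)))
    (fun s hs => by
      have := hanti (hsub (Ioo_subset_Icc_self hs)) ht hs.2.le
      simp only at this
      linarith)
  have h2 := monotoneOn_Icc_of_hasDerivWithinAt (f := fun s => u₁ t * s - u s)
    (fun s hs => ((hasDerivWithinAt_id s _).const_mul (u₁ t)).sub ((hu s (hsub' hs)).mono hsub'))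
    (fun s hs => by
      have := hanti ht (hsub' (Ioo_subset_Icc_self hs)) hs.1.le
      simp only at this
      linarith)
  have h1 := h1 (left_mem_Icc.2 ht.1) (right_mem_Icc.2 ht.1) ht.1
  have h2 := h2 (left_mem_Icc.2 ht.2) (right_mem_Icc.2 ht.2) ht.2
  simp only [h0] at h1 h2
  nlinarith [mul_le_mul_of_nonneg_left h1 (sub_nonneg.2 ht.2), mul_le_mul_of_nonneg_left h2 ht.1]

/-! ### Lane–Emden pairs -/

/-- `(u, w)` solves `-u'' = w ^ a`, `-w'' = lam * u ^ b` on `[0, T]`, starts from `(0, 0)` and is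
positive on `(0, T)`; `u₁` and `w₁` are the derivatives of `u` and `w`. -/
structure LaneEmdenPair (a b lam T : ℝ) (u u₁ w w₁ : ℝ → ℝ) : Prop where
  hu : ∀ t ∈ Icc 0 T, HasDerivWithinAt u (u₁ t) (Icc 0 T) t
  hu₁ : ∀ t ∈ Icc 0 T, HasDerivWithinAt u₁ (-(w t) ^ a) (Icc 0 T) t
  hw : ∀ t ∈ Icc 0 T, HasDerivWithinAt w (w₁ t) (Icc 0 T) t
  hw₁ : ∀ t ∈ Icc 0 T, HasDerivWithinAt w₁ (-(lam * (u t) ^ b)) (Icc 0 T) t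
  u_zero : u 0 = 0
  w_zero : w 0 = 0
  u_pos : ∀ t ∈ Ioo 0 T, 0 < u t
  w_pos : ∀ t ∈ Ioo 0 T, 0 < w t

namespace LaneEmdenPair

variable {a b lam T : ℝ} {u u₁ w w₁ v v₁ z z₁ : ℝ → ℝ}

lemma mono (P : LaneEmdenPair a b lam T u u₁ w w₁) {S : ℝ} (hS : S ≤ T) :
    LaneEmdenPair a b lam S u u₁ w w₁ where
  hu t ht := (P.hu t ⟨ht.1, ht.2.trans hS⟩).mono (Icc_subset_Icc_right hS)
  hu₁ t ht := (P.hu₁ t ⟨ht.1, ht.2.trans hS⟩).mono (Icc_subset_Icc_right hS)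
  hw t ht := (P.hw t ⟨ht.1, ht.2.trans hS⟩).mono (Icc_subset_Icc_right hS)
  hw₁ t ht := (P.hw₁ t ⟨ht.1, ht.2.trans hS⟩).mono (Icc_subset_Icc_right hS)
  u_zero := P.u_zero
  w_zero := P.w_zero
  u_pos t ht := P.u_pos t ⟨ht.1, ht.2.trans_le hS⟩
  w_pos t ht := P.w_pos t ⟨ht.1, ht.2.trans_le hS⟩

lemma continuousOn_u (P : LaneEmdenPair a b lam T u u₁ w w₁) : ContinuousOn u (Icc 0 T) :=
  fun t ht => (P.hu t ht).continuousWithinAt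

lemma continuousOn_w (P : LaneEmdenPair a b lam T u u₁ w w₁) : ContinuousOn w (Icc 0 T) :=
  fun t ht => (P.hw t ht).continuousWithinAt

lemma nonneg_of_pos {f : ℝ → ℝ} (hT : 0 < T) (hc : ContinuousOn f (Icc 0 T))
    (hp : ∀ t ∈ Ioo 0 T, 0 < f t) : ∀ t ∈ Icc 0 T, 0 ≤ f t := by
  intro t ht
  have hm : MapsTo f (closure (Ioo 0 T)) (closure (Ici 0)) :=
    MapsTo.closure_of_continuousOn (fun s hs => (hp s hs).le)
      (by rwa [closure_Ioo hT.ne])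
  rw [closure_Ioo hT.ne, closure_Ici] at hm
  exact hm ht

lemma u_nonneg (hT : 0 < T) (P : LaneEmdenPair a b lam T u u₁ w w₁) : ∀ t ∈ Icc 0 T, 0 ≤ u t :=
  nonneg_of_pos hT P.continuousOn_u P.u_pos

lemma w_nonneg (hT : 0 < T) (P : LaneEmdenPair a b lam T u u₁ w w₁) : ∀ t ∈ Icc 0 T, 0 ≤ w t :=
  nonneg_of_pos hT P.continuousOn_w P.w_pos

/-- Since `u₁` is nonincreasing, a nonpositive initial slope would keep `u` below `u 0 = 0`. Slopes
can therefore be normalised by division. -/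
lemma slope_pos (hT : 0 < T) (P : LaneEmdenPair a b lam T u u₁ w w₁) : 0 < u₁ 0 := by
  by_contra! hcon
  have hanti : MonotoneOn (fun s => -u₁ s) (Icc 0 T) :=
    monotoneOn_Icc_of_hasDerivWithinAt (fun s hs => (P.hu₁ s hs).neg)
      fun s hs => by simpa using Real.rpow_nonneg (P.w_pos s hs).le a
  have h0 : (0 : ℝ) ∈ Icc 0 T := left_mem_Icc.2 hT.le
  have hm := monotoneOn_Icc_of_hasDerivWithinAt (f := fun s => -u s)
    (fun s hs => (P.hu s hs).neg) fun s hs => by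
      have := hanti h0 (Ioo_subset_Icc_self hs) hs.1.le
      simp only at this
      linarith
  have := hm h0 ⟨by linarith, by linarith⟩ (by linarith : (0 : ℝ) ≤ T / 2)
  have := P.u_pos (T / 2) ⟨by linarith, by linarith⟩
  simp only [P.u_zero] at *
  linarith

/-- Two pairs with the same initial slope of the first component separate monotonically. -/
lemma lt_of_slope_lt (ha : 0 < a) (hb : 0 < b) (hlam : 0 < lam) (hT : 0 < T)
    (P : LaneEmdenPair a b lam T u u₁ w w₁) (Q : LaneEmdenPair a b lam T v v₁ z z₁)
    (hu : u₁ 0 = v₁ 0) (hw : w₁ 0 < z₁ 0) : v T < u T ∧ w T < z T := by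
  have h0 : (0 : ℝ) ∈ Icc 0 T := left_mem_Icc.2 hT.le
  have hTT : T ∈ Icc 0 T := right_mem_Icc.2 hT.le
  -- Bootstrap: `z₁ > w₁` before `τ` gives `w < z`, hence `u' ≥ v'` and `u ≥ v`, hence `z₁ - w₁` is
  -- nondecreasing and still positive at `τ`. A first time at which `z₁ ≤ w₁` is thus impossible.
  have key : ∀ τ ∈ Icc 0 T, (∀ t ∈ Ico 0 τ, 0 < z₁ t - w₁ t) →
      0 < z₁ τ - w₁ τ ∧ ∀ t ∈ Ioc 0 τ, w t < z t := by
    intro τ hτ hpos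
    have hsub : Icc 0 τ ⊆ Icc 0 T := Icc_subset_Icc_right hτ.2
    have h0τ : (0 : ℝ) ∈ Icc 0 τ := left_mem_Icc.2 hτ.1
    have he : StrictMonoOn (fun t => z t - w t) (Icc 0 τ) :=
      strictMonoOn_Icc_of_hasDerivWithinAt
        (fun s hs => ((Q.hw s (hsub hs)).mono hsub).sub ((P.hw s (hsub hs)).mono hsub))
        fun s hs => hpos s (Ioo_subset_Ico_self hs)
    have he' : ∀ t ∈ Ioc 0 τ, w t < z t := fun t ht => by
      have := he h0τ (Ioc_subset_Icc_self ht) ht.1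
      simp only [P.w_zero, Q.w_zero] at this
      linarith
    have hd1 : MonotoneOn (fun t => u₁ t - v₁ t) (Icc 0 τ) :=
      monotoneOn_Icc_of_hasDerivWithinAt
        (fun s hs => ((P.hu₁ s (hsub hs)).mono hsub).sub ((Q.hu₁ s (hsub hs)).mono hsub))
        fun s hs => by
          have := Real.rpow_le_rpow (P.w_nonneg hT s (hsub (Ioo_subset_Icc_self hs)))
            (he' s (Ioo_subset_Ioc_self hs)).le ha.le
          linarith
    have hd : MonotoneOn (fun t => u t - v t) (Icc 0 τ) :=
      monotoneOn_Icc_of_hasDerivWithinAt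
        (fun s hs => ((P.hu s (hsub hs)).mono hsub).sub ((Q.hu s (hsub hs)).mono hsub))
        fun s hs => by
          have := hd1 h0τ (Ioo_subset_Icc_self hs) hs.1.le
          simp only [hu] at this
          linarith
    have he1 : MonotoneOn (fun t => z₁ t - w₁ t) (Icc 0 τ) :=
      monotoneOn_Icc_of_hasDerivWithinAt
        (fun s hs => ((Q.hw₁ s (hsub hs)).mono hsub).sub ((P.hw₁ s (hsub hs)).mono hsub))
        fun s hs => by
          have h1 := hd h0τ (Ioo_subset_Icc_self hs) hs.1.le
          simp only [P.u_zero, Q.u_zero] at h1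
          have := Real.rpow_le_rpow (Q.u_nonneg hT s (hsub (Ioo_subset_Icc_self hs)))
            (by linarith : v s ≤ u s) hb.le
          nlinarith
    have := he1 h0τ (right_mem_Icc.2 hτ.1) hτ.1
    simp only at this
    exact ⟨by linarith, he'⟩
  have hpos : ∀ t ∈ Icc 0 T, 0 < z₁ t - w₁ t := by
    by_contra! hcon
    have hc : ContinuousOn (fun t => z₁ t - w₁ t) (Icc 0 T) := fun t ht =>
      (Q.hw₁ t ht).continuousWithinAt.sub (P.hw₁ t ht).continuousWithinAt
    have hclosed : IsClosed (Icc 0 T ∩ (fun t => z₁ t - w₁ t) ⁻¹' Iic 0) :=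
      hc.preimage_isClosed_of_isClosed isClosed_Icc isClosed_Iic
    obtain ⟨t, ht, ht'⟩ := hcon
    obtain ⟨τ, hτ, hmin⟩ := (isCompact_Icc.of_isClosed_subset hclosed
      inter_subset_left).exists_isLeast ⟨t, ht, ht'⟩
    have := (key τ hτ.1 fun s hs => by
      by_contra! hs'
      exact absurd (hmin ⟨⟨hs.1, hs.2.le.trans hτ.1.2⟩, hs'⟩) (not_le.2 hs.2)).1
    exact absurd hτ.2 (not_le.2 this)
  have hwz : ∀ t ∈ Ioc 0 T, w t < z t :=
    (key T hTT fun s hs => hpos s (Ico_subset_Icc_self hs)).2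
  refine ⟨?_, hwz T (right_mem_Ioc.2 hT)⟩
  have hd1 : StrictMonoOn (fun t => u₁ t - v₁ t) (Icc 0 T) :=
    strictMonoOn_Icc_of_hasDerivWithinAt (fun s hs => (P.hu₁ s hs).sub (Q.hu₁ s hs))
      fun s hs => by
        have := Real.rpow_lt_rpow (P.w_pos s hs).le (hwz s (Ioo_subset_Ioc_self hs)) ha
        linarith
  have hd : StrictMonoOn (fun t => u t - v t) (Icc 0 T) :=
    strictMonoOn_Icc_of_hasDerivWithinAt (fun s hs => (P.hu s hs).sub (Q.hu s hs))
      fun s hs => by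
        have := hd1 h0 (Ioo_subset_Icc_self hs) hs.1
        simp only [hu] at this
        linarith
  have := hd h0 hTT hT
  simp only [P.u_zero, Q.u_zero] at this
  linarith

end LaneEmdenPair

/-! ### Uniqueness for the singular initial value problem -/

/-- The coefficient `K / t` is singular, but `d` and `e` vanish at `0`, so each is at most `t` times
a bound on its derivative, and this factor cancels the singularity. What remains is a Gronwall
estimate for `d₁` and `e₁` in the norm weighted by `exp (-L t)`. -/
lemma eq_zero_of_abs_deriv2_le {T K : ℝ} {d d₁ d₂ e e₁ e₂ : ℝ → ℝ} (hT : 0 ≤ T) (hK : 0 ≤ K)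
    (hd : ∀ t ∈ Icc 0 T, HasDerivWithinAt d (d₁ t) (Icc 0 T) t)
    (hd₁ : ∀ t ∈ Icc 0 T, HasDerivWithinAt d₁ (d₂ t) (Icc 0 T) t)
    (he : ∀ t ∈ Icc 0 T, HasDerivWithinAt e (e₁ t) (Icc 0 T) t)
    (he₁ : ∀ t ∈ Icc 0 T, HasDerivWithinAt e₁ (e₂ t) (Icc 0 T) t)
    (d0 : d 0 = 0) (d10 : d₁ 0 = 0) (d20 : d₂ 0 = 0)
    (e0 : e 0 = 0) (e10 : e₁ 0 = 0) (e20 : e₂ 0 = 0)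
    (h1 : ∀ t ∈ Icc 0 T, t * |d₂ t| ≤ K * |e t|) (h2 : ∀ t ∈ Icc 0 T, t * |e₂ t| ≤ K * |d t|) :
    ∀ t ∈ Icc 0 T, d t = 0 ∧ e t = 0 := by
  -- Any `L > 2 * K` works: the estimate closes as `N ≤ (2 * K / L) * N`.
  set L : ℝ := 4 * K + 1 with hL
  have hLpos : 0 < L := by positivity
  have hc : ContinuousOn (fun t => Real.exp (-(L * t)) * (|d₁ t| + |e₁ t|)) (Icc 0 T) := by
    have h3 : ContinuousOn d₁ (Icc 0 T) := fun t ht => (hd₁ t ht).continuousWithinAt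
    have h4 : ContinuousOn e₁ (Icc 0 T) := fun t ht => (he₁ t ht).continuousWithinAt
    exact (by fun_prop : Continuous fun t : ℝ => Real.exp (-(L * t))).continuousOn.mul
      (h3.abs.add h4.abs)
  obtain ⟨τ, hτ, hmax⟩ := isCompact_Icc.exists_isMaxOn ⟨0, left_mem_Icc.2 hT⟩ hc
  set N : ℝ := Real.exp (-(L * τ)) * (|d₁ τ| + |e₁ τ|) with hN
  have hN0 : 0 ≤ N := by positivity
  have hsum : ∀ t ∈ Icc 0 T, |d₁ t| + |e₁ t| ≤ N * Real.exp (L * t) := by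
    intro t ht
    have h3 : Real.exp (-(L * t)) * (|d₁ t| + |e₁ t|) ≤ N := hmax ht
    rw [Real.exp_neg, inv_mul_le_iff₀ (Real.exp_pos _)] at h3
    linarith
  have first : ∀ f f₁ : ℝ → ℝ, (∀ t ∈ Icc 0 T, HasDerivWithinAt f (f₁ t) (Icc 0 T) t) →
      f 0 = 0 → (∀ t ∈ Icc 0 T, |f₁ t| ≤ N * Real.exp (L * t)) →
      ∀ t ∈ Icc 0 T, |f t| ≤ t * (N * Real.exp (L * t)) := by
    intro f f₁ hf f0 hb t ht
    have hsub : Icc 0 t ⊆ Icc 0 T := Icc_subset_Icc_right ht.2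
    have := Convex.norm_image_sub_le_of_norm_hasDerivWithin_le
      (C := N * Real.exp (L * t)) (fun s hs => (hf s (hsub hs)).mono hsub)
      (fun s hs => (hb s (hsub hs)).trans (by have := hs.2; gcongr)) (convex_Icc 0 t)
      (left_mem_Icc.2 ht.1) (right_mem_Icc.2 ht.1)
    simp only [f0, sub_zero, Real.norm_eq_abs, abs_of_nonneg ht.1] at this
    linarith
  have second : ∀ f₁ f₂ g : ℝ → ℝ, (∀ t ∈ Icc 0 T, HasDerivWithinAt f₁ (f₂ t) (Icc 0 T) t) →
      f₁ 0 = 0 → f₂ 0 = 0 → (∀ t ∈ Icc 0 T, t * |f₂ t| ≤ K * |g t|) →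
      (∀ t ∈ Icc 0 T, |g t| ≤ t * (N * Real.exp (L * t))) →
      ∀ t ∈ Icc 0 T, |f₁ t| ≤ K * N / L * Real.exp (L * t) := by
    intro f₁ f₂ g hf f10 f20 hb hg t ht
    refine image_norm_le_of_norm_deriv_right_le_deriv_boundary
      (B := fun t => K * N / L * Real.exp (L * t)) (B' := fun t => K * N * Real.exp (L * t))
      (fun s hs => (hf s hs).continuousWithinAt)
      (fun s hs => ((hf s (Ico_subset_Icc_self hs)).mono_of_mem_nhdsWithin ?_)) ?_ ?_ ?_ ht
    · exact Filter.mem_of_superset (Icc_mem_nhdsGE hs.2) (Icc_subset_Icc_left hs.1)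
    · simp only [f10, norm_zero]; positivity
    · intro s
      have h3 : HasDerivAt (fun t => Real.exp (L * t)) (Real.exp (L * s) * (L * 1)) s :=
        ((hasDerivAt_id s).const_mul L).exp
      have h4 := h3.const_mul (K * N / L)
      rwa [show K * N / L * (Real.exp (L * s) * (L * 1)) = K * N * Real.exp (L * s) by
        field_simp] at h4
    · intro s hs
      have hs' := Ico_subset_Icc_self hs
      -- At `s = 0` the weighted hypothesis is void, so the vanishing of `f₂ 0` is used instead.
      rcases hs.1.eq_or_lt with h | h
      · rw [← h, f20, norm_zero]; positivity
      · have h3 := (hb s hs').trans (mul_le_mul_of_nonneg_left (hg s hs') hK)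
        rw [Real.norm_eq_abs]
        refine le_of_mul_le_mul_left ?_ h
        linarith
  have hb1 : ∀ t ∈ Icc 0 T, |d₁ t| ≤ N * Real.exp (L * t) := fun t ht =>
    (le_add_of_nonneg_right (abs_nonneg _)).trans (hsum t ht)
  have hb2 : ∀ t ∈ Icc 0 T, |e₁ t| ≤ N * Real.exp (L * t) := fun t ht =>
    (le_add_of_nonneg_left (abs_nonneg _)).trans (hsum t ht)
  have hd' := first d d₁ hd d0 hb1
  have he' := first e e₁ he e0 hb2
  have hN00 : N = 0 := by
    have h3 := second d₁ d₂ e hd₁ d10 d20 h1 he' τ hτ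
    have h4 := second e₁ e₂ d he₁ e10 e20 h2 hd' τ hτ
    have h5 : N * Real.exp (L * τ) = |d₁ τ| + |e₁ τ| := by
      rw [hN, mul_right_comm, ← Real.exp_add]
      simp
    have h6 : N * Real.exp (L * τ) ≤ 2 * (K * N / L) * Real.exp (L * τ) := by linarith
    have h7 := le_of_mul_le_mul_right h6 (Real.exp_pos _)
    have h8 : N * L ≤ 2 * (K * N) := by
      rw [show 2 * (K * N / L) = 2 * (K * N) / L by ring, le_div_iff₀ hLpos] at h7
      exact h7
    nlinarith [mul_nonneg hK hN0]
  intro t ht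
  have h3 := hd' t ht
  have h4 := he' t ht
  simp only [hN00, zero_mul, mul_zero, abs_nonpos_iff] at h3 h4
  exact ⟨h3, h4⟩

/-- Mean value inequality; writing `s ^ (b - 1)` as `s ^ b / s ≤ M ^ b / m` covers `b < 1` and `b ≥
1` together. -/
lemma abs_rpow_sub_rpow_le {b m M x y : ℝ} (hb : 0 < b) (hm : 0 < m) (hx : x ∈ Icc m M)
    (hy : y ∈ Icc m M) : |x ^ b - y ^ b| ≤ b * M ^ b / m * |x - y| := by
  have := Convex.norm_image_sub_le_of_norm_hasDerivWithin_le (f := fun s : ℝ => s ^ b)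
    (f' := fun s => b * s ^ (b - 1)) (C := b * M ^ b / m) (s := Icc m M)
    (fun s hs => (Real.hasDerivAt_rpow_const (Or.inl (hm.trans_le hs.1).ne')).hasDerivWithinAt)
    (fun s hs => by
      have hs0 : 0 < s := hm.trans_le hs.1
      rw [Real.norm_eq_abs, abs_of_nonneg (by positivity), Real.rpow_sub_one hs0.ne', mul_div_assoc]
      have := hs.1
      have := hs.2
      have : 0 ≤ M := hs0.le.trans hs.2
      have := Real.rpow_nonneg this b
      gcongr) (convex_Icc m M) hy hx
  simpa using this

namespace LaneEmdenPair

variable {a b lam T : ℝ} {u u₁ w w₁ v v₁ z z₁ : ℝ → ℝ}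

/-- The chord inequalities give `f t, g t ≥ c * t`, so the power has Lipschitz constant of order `1
/ t` between the two values; the weight `t` removes it. -/
lemma mul_abs_rpow_sub_le {f g : ℝ → ℝ} (hb : 0 < b) (hT : 0 < T)
    (hf : ContinuousOn f (Icc 0 T)) (hg : ContinuousOn g (Icc 0 T)) (hf0 : 0 < f T) (hg0 : 0 < g T)
    (hf' : ∀ t ∈ Icc 0 T, t * f T ≤ T * f t) (hg' : ∀ t ∈ Icc 0 T, t * g T ≤ T * g t) :
    ∃ K, 0 ≤ K ∧ ∀ t ∈ Icc 0 T, t * |f t ^ b - g t ^ b| ≤ K * |f t - g t| := by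
  obtain ⟨M₁, hM₁⟩ := isCompact_Icc.bddAbove_image hf
  obtain ⟨M₂, hM₂⟩ := isCompact_Icc.bddAbove_image hg
  set M := max M₁ M₂
  set c := min (f T) (g T) / T
  have hc : 0 < c := div_pos (lt_min hf0 hg0) hT
  have hTT : T ∈ Icc 0 T := right_mem_Icc.2 hT.le
  have hM : 0 ≤ M := hf0.le.trans ((hM₁ (mem_image_of_mem f hTT)).trans (le_max_left _ _))
  refine ⟨b * M ^ b / c, by positivity, fun t ht => ?_⟩
  rcases ht.1.eq_or_lt with h | h
  · rw [← h, zero_mul]; positivity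
  have hcf : t * c ≤ f t := by
    have : t * min (f T) (g T) ≤ T * f t :=
      (mul_le_mul_of_nonneg_left (min_le_left _ _) ht.1).trans (hf' t ht)
    rw [← mul_div_assoc, div_le_iff₀ hT]
    linarith
  have hcg : t * c ≤ g t := by
    have : t * min (f T) (g T) ≤ T * g t :=
      (mul_le_mul_of_nonneg_left (min_le_right _ _) ht.1).trans (hg' t ht)
    rw [← mul_div_assoc, div_le_iff₀ hT]
    linarith
  have := abs_rpow_sub_rpow_le hb (mul_pos h hc)
    ⟨hcf, (hM₁ (mem_image_of_mem f ht)).trans (le_max_left _ _)⟩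
    ⟨hcg, (hM₂ (mem_image_of_mem g ht)).trans (le_max_right _ _)⟩
  refine (mul_le_mul_of_nonneg_left this h.le).trans (le_of_eq ?_)
  change t * (b * M ^ b / (t * c) * |f t - g t|) = b * M ^ b / c * |f t - g t|
  field_simp

lemma eqOn_of_slope_eq (ha : 0 < a) (hb : 0 < b) (hlam : 0 < lam) (hT : 0 < T)
    (P : LaneEmdenPair a b lam T u u₁ w w₁) (Q : LaneEmdenPair a b lam T v v₁ z z₁)
    (hu : u₁ 0 = v₁ 0) (hw : w₁ 0 = z₁ 0) : EqOn u v (Icc 0 T) := by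
  -- Stopping at `S < T` keeps all components positive at the right end, as the chord bounds
  -- require; continuity recovers `T`.
  have key : ∀ S ∈ Ioo 0 T, u S = v S := by
    intro S hS
    have P' := P.mono hS.2.le
    have Q' := Q.mono hS.2.le
    have cu := fun t (ht : t ∈ Icc 0 S) => le_mul_of_hasDerivWithinAt_nonpos P'.hu P'.hu₁
      (fun s hs => by simpa using Real.rpow_nonneg (P'.w_pos s hs).le a) P'.u_zero ht
    have cv := fun t (ht : t ∈ Icc 0 S) => le_mul_of_hasDerivWithinAt_nonpos Q'.hu Q'.hu₁
      (fun s hs => by simpa using Real.rpow_nonneg (Q'.w_pos s hs).le a) Q'.u_zero ht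
    have cw := fun t (ht : t ∈ Icc 0 S) => le_mul_of_hasDerivWithinAt_nonpos P'.hw P'.hw₁
      (fun s hs => neg_nonpos.2 (mul_nonneg hlam.le (Real.rpow_nonneg (P'.u_pos s hs).le b)))
      P'.w_zero ht
    have cz := fun t (ht : t ∈ Icc 0 S) => le_mul_of_hasDerivWithinAt_nonpos Q'.hw Q'.hw₁
      (fun s hs => neg_nonpos.2 (mul_nonneg hlam.le (Real.rpow_nonneg (Q'.u_pos s hs).le b)))
      Q'.w_zero ht
    obtain ⟨K₁, hK₁, h1⟩ := mul_abs_rpow_sub_le ha hS.1 P'.continuousOn_w Q'.continuousOn_w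
      (P.w_pos S hS) (Q.w_pos S hS) cw cz
    obtain ⟨K₂, hK₂, h2⟩ := mul_abs_rpow_sub_le hb hS.1 P'.continuousOn_u Q'.continuousOn_u
      (P.u_pos S hS) (Q.u_pos S hS) cu cv
    have := (eq_zero_of_abs_deriv2_le (K := K₁ + lam * K₂) hS.1.le (by positivity)
      (fun t ht => (P'.hu t ht).sub (Q'.hu t ht)) (fun t ht => (P'.hu₁ t ht).sub (Q'.hu₁ t ht))
      (fun t ht => (P'.hw t ht).sub (Q'.hw t ht)) (fun t ht => (P'.hw₁ t ht).sub (Q'.hw₁ t ht))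
      (by simp [P.u_zero, Q.u_zero]) (by simp [hu]) (by simp [P.w_zero, Q.w_zero])
      (by simp [P.w_zero, Q.w_zero]) (by simp [hw]) (by simp [P.u_zero, Q.u_zero])
      (fun t ht => by
        have h3 : |-(w t) ^ a - -(z t) ^ a| = |w t ^ a - z t ^ a| := by
          rw [← abs_neg]; congr 1; ring
        rw [h3]
        refine (h1 t ht).trans ?_
        rw [add_mul]
        exact le_add_of_nonneg_right (by positivity))
      (fun t ht => by
        have h3 : |-(lam * u t ^ b) - -(lam * v t ^ b)| = lam * |u t ^ b - v t ^ b| := by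
          rw [← abs_of_pos hlam, ← abs_mul, ← abs_neg, abs_of_pos hlam]; congr 1; ring
        rw [h3]
        have := mul_le_mul_of_nonneg_left (h2 t ht) hlam.le
        have : 0 ≤ K₁ * |u t - v t| := by positivity
        simp only [Pi.sub_apply]
        linarith) S (right_mem_Icc.2 hS.1.le)).1
    exact sub_eq_zero.1 this
  have hcl : EqOn u v (closure (Ioo 0 T)) := by
    refine EqOn.of_subset_closure (s := Ioo 0 T) (t := closure (Ioo 0 T)) key ?_ ?_ subset_closure
      subset_rfl
    · rw [closure_Ioo hT.ne]; exact P.continuousOn_u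
    · rw [closure_Ioo hT.ne]; exact Q.continuousOn_u
  rwa [closure_Ioo hT.ne] at hcl

/-- Two pairs with the same initial slope of the first component, each vanishing at the right end
of its interval, coincide. -/
theorem unique_of_slope_eq {S : ℝ} (ha : 0 < a) (hb : 0 < b) (hlam : 0 < lam) (hT : 0 < T)
    (hS : 0 < S) (P : LaneEmdenPair a b lam T u u₁ w w₁) (Q : LaneEmdenPair a b lam S v v₁ z z₁)
    (huT : u T = 0) (hwT : w T = 0) (hvS : v S = 0) (hzS : z S = 0)
    (hslope : u₁ 0 = v₁ 0) : T = S ∧ EqOn u v (Icc 0 T) := by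
  set R := min T S with hR
  have hR0 : 0 < R := lt_min hT hS
  have P' := P.mono (min_le_left T S)
  have Q' := Q.mono (min_le_right T S)
  have hRR : R ∈ Icc 0 R := right_mem_Icc.2 hR0.le
  have e1 := P'.u_nonneg hR0 R hRR
  have e2 := P'.w_nonneg hR0 R hRR
  have e3 := Q'.u_nonneg hR0 R hRR
  have e4 := Q'.w_nonneg hR0 R hRR
  have hcase : R = T ∨ R = S := min_choice T S
  -- At `R` one pair has both components zero and the other is nonnegative, whereas unequal slopes
  -- order the two components oppositely.
  rcases lt_trichotomy (w₁ 0) (z₁ 0) with h | h | h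
  · obtain ⟨h1, h2⟩ := lt_of_slope_lt ha hb hlam hR0 P' Q' hslope h
    rcases hcase with h3 | h3 <;> rw [h3] at h1 h2 e1 e2 e3 e4 <;> linarith
  · have heq := eqOn_of_slope_eq ha hb hlam hR0 P' Q' hslope h
    have hTS : T = S := by
      have h1 := heq hRR
      rcases hcase with h3 | h3
      · by_contra hne
        have : T < S := lt_of_le_of_ne (by rw [← h3]; exact min_le_right _ _) hne
        have := Q.u_pos T ⟨hT, this⟩
        rw [h3] at h1
        linarith
      · by_contra hne
        have : S < T := lt_of_le_of_ne (by rw [← h3]; exact min_le_left _ _) (Ne.symm hne)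
        have := P.u_pos S ⟨hS, this⟩
        rw [h3] at h1
        linarith
    refine ⟨hTS, ?_⟩
    rwa [hR, ← hTS, min_self] at heq
  · obtain ⟨h1, h2⟩ := lt_of_slope_lt ha hb hlam hR0 Q' P' hslope.symm h
    rcases hcase with h3 | h3 <;> rw [h3] at h1 h2 e1 e2 e3 e4 <;> linarith

/-- Rescaling of both components and of the variable. -/
lemma scale (hT : 0 < T) {A B μ lam' : ℝ} (hA : 0 < A) (hB : 0 < B) (hμ : 0 < μ)
    (h1 : A * μ ^ 2 = B ^ a) (h2 : B * μ ^ 2 * lam = lam' * A ^ b)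
    (P : LaneEmdenPair a b lam T u u₁ w w₁) :
    LaneEmdenPair a b lam' (T / μ) (fun t => A * u (μ * t)) (fun t => A * μ * u₁ (μ * t))
      (fun t => B * w (μ * t)) (fun t => B * μ * w₁ (μ * t)) := by
  have hmaps : MapsTo (fun t => μ * t) (Icc 0 (T / μ)) (Icc 0 T) := fun t ht =>
    ⟨mul_nonneg hμ.le ht.1, by have := (le_div_iff₀ hμ).1 ht.2; linarith⟩
  have hmaps' : MapsTo (fun t => μ * t) (Ioo 0 (T / μ)) (Ioo 0 T) := fun t ht =>
    ⟨mul_pos hμ ht.1, by have := (lt_div_iff₀ hμ).1 ht.2; linarith⟩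
  have comp : ∀ (f : ℝ → ℝ) (y k t : ℝ), t ∈ Icc 0 (T / μ) →
      HasDerivWithinAt f y (Icc 0 T) (μ * t) →
      HasDerivWithinAt (fun t => k * f (μ * t)) (k * (y * μ)) (Icc 0 (T / μ)) t := by
    intro f y k t ht hf
    have h3 : HasDerivWithinAt (fun t => μ * t) μ (Icc 0 (T / μ)) t := by
      simpa using (hasDerivWithinAt_id t (Icc 0 (T / μ))).const_mul μ
    exact (hf.comp t h3 hmaps).const_mul k
  refine ⟨fun t ht => ?_, fun t ht => ?_, fun t ht => ?_, fun t ht => ?_, ?_, ?_, ?_, ?_⟩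
  · convert comp u _ A t ht (P.hu _ (hmaps ht)) using 1; ring
  · convert comp u₁ _ (A * μ) t ht (P.hu₁ _ (hmaps ht)) using 1
    rw [Real.mul_rpow hB.le (P.w_nonneg hT _ (hmaps ht)), ← h1]
    ring
  · convert comp w _ B t ht (P.hw _ (hmaps ht)) using 1; ring
  · convert comp w₁ _ (B * μ) t ht (P.hw₁ _ (hmaps ht)) using 1
    rw [Real.mul_rpow hA.le (P.u_nonneg hT _ (hmaps ht)), ← mul_assoc lam', ← h2]
    ring
  · simp [P.u_zero]
  · simp [P.w_zero]
  · exact fun t ht => mul_pos hA (P.u_pos _ (hmaps' ht))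
  · exact fun t ht => mul_pos hB (P.w_pos _ (hmaps' ht))

/-- Two pairs on the same interval, vanishing at the right end, differ by constant factors. -/
theorem exists_eqOn_mul (ha : 0 < a) (hb : 0 < b) {lam' : ℝ} (hlam : 0 < lam) (hlam' : 0 < lam')
    (hT : 0 < T) (P : LaneEmdenPair a b lam T u u₁ w w₁) (Q : LaneEmdenPair a b lam' T v v₁ z z₁)
    (huT : u T = 0) (hwT : w T = 0) (hvT : v T = 0) (hzT : z T = 0) :
    ∃ A > 0, EqOn u (fun t => A * v t) (Icc 0 T) ∧ A ^ (1 / a) * lam' = lam * A ^ b := by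
  set c := u₁ 0 / v₁ 0 with hc
  have hc0 : 0 < c := div_pos (P.slope_pos hT) (Q.slope_pos hT)
  -- Matching slopes requires `A * μ = c`, and the first equation requires `B = (c * μ) ^ (1 / a)`.
  -- The second then becomes `μ ^ k = lam / lam' * c ^ (b - 1 / a)`.
  set k := 1 / a + 2 + b with hk
  have hk0 : 0 < k := by positivity
  set μ := (lam / lam' * c ^ (b - 1 / a)) ^ (1 / k) with hμdef
  have hμ : 0 < μ := by positivity
  have hμk : μ ^ k = lam / lam' * c ^ (b - 1 / a) := by
    rw [hμdef, ← Real.rpow_mul (by positivity), one_div_mul_cancel hk0.ne', Real.rpow_one]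
  have hA : 0 < c / μ := by positivity
  have hB : 0 < (c * μ) ^ (1 / a) := by positivity
  have h1 : c / μ * μ ^ 2 = ((c * μ) ^ (1 / a)) ^ a := by
    rw [← Real.rpow_mul (by positivity), one_div_mul_cancel ha.ne', Real.rpow_one]
    field_simp
  have h2 : (c * μ) ^ (1 / a) * μ ^ 2 * lam' = lam * (c / μ) ^ b := by
    rw [hk, Real.rpow_add hμ, Real.rpow_add hμ, Real.rpow_two, Real.rpow_sub hc0] at hμk
    rw [Real.mul_rpow hc0.le hμ.le, Real.div_rpow hc0.le hμ.le]
    field_simp at hμk ⊢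
    linarith
  have Q' := Q.scale hT hA hB hμ h1 h2
  obtain ⟨hTe, heq⟩ := unique_of_slope_eq ha hb hlam hT (div_pos hT hμ) P Q' huT hwT
    (by simp only [mul_div_cancel₀ T hμ.ne', hvT, mul_zero])
    (by simp only [mul_div_cancel₀ T hμ.ne', hzT, mul_zero])
    (by
      have := (Q.slope_pos hT).ne'
      simp only [mul_zero, hc]
      field_simp)
  -- The intervals satisfy `T = T / μ`; with `μ = 1` the scaling condition `h2` is the claimed
  -- relation.
  have hμ1 : μ = 1 := by
    field_simp at hTe
    exact hTe
  rw [hμ1] at heq h2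
  simp only [div_one, one_mul, mul_one, one_pow] at heq h2
  exact ⟨c, hc0, heq, h2⟩

end LaneEmdenPair

/-! ### The Dirichlet problem `-u'' = f` -/

/-- The solution of `-u'' = f`, `u 0 = u T = 0`. -/
noncomputable def dirichletSolution (T : ℝ) (f : ℝ → ℝ) (t : ℝ) : ℝ :=
  (T - t) / T * (∫ s in (0 : ℝ)..t, s * f s) + t / T * ∫ s in t..T, (T - s) * f s

/-- The derivative of `dirichletSolution`. -/
noncomputable def dirichletSolutionDeriv (T : ℝ) (f : ℝ → ℝ) (t : ℝ) : ℝ :=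
  -1 / T * (∫ s in (0 : ℝ)..t, s * f s) + 1 / T * ∫ s in t..T, (T - s) * f s

section Dirichlet

variable {T : ℝ} {f : ℝ → ℝ}

lemma hasDerivAt_integral_left (hf : Continuous f) (T t : ℝ) :
    HasDerivAt (fun t => ∫ s in t..T, f s) (-f t) t :=
  intervalIntegral.integral_hasDerivAt_left (hf.intervalIntegrable _ _)
    hf.aestronglyMeasurable.stronglyMeasurableAtFilter hf.continuousAt

lemma hasDerivAt_integral_right (hf : Continuous f) (a t : ℝ) :
    HasDerivAt (fun t => ∫ s in a..t, f s) (f t) t :=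
  intervalIntegral.integral_hasDerivAt_right (hf.intervalIntegrable _ _)
    hf.aestronglyMeasurable.stronglyMeasurableAtFilter hf.continuousAt

lemma hasDerivAt_dirichletSolution (hT : 0 < T) (hf : Continuous f) (t : ℝ) :
    HasDerivAt (dirichletSolution T f) (dirichletSolutionDeriv T f t) t := by
  have h1 := hasDerivAt_integral_right (by fun_prop : Continuous fun s => s * f s) 0 t
  have h2 := hasDerivAt_integral_left (by fun_prop : Continuous fun s => (T - s) * f s) T t
  have h3 := ((((hasDerivAt_id t).const_sub T).div_const T).mul h1).add
    (((hasDerivAt_id t).div_const T).mul h2)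
  refine h3.congr_deriv ?_
  simp only [dirichletSolutionDeriv, id]
  field_simp
  ring

lemma hasDerivAt_dirichletSolutionDeriv (hT : 0 < T) (hf : Continuous f) (t : ℝ) :
    HasDerivAt (dirichletSolutionDeriv T f) (-f t) t := by
  have h1 := hasDerivAt_integral_right (by fun_prop : Continuous fun s => s * f s) 0 t
  have h2 := hasDerivAt_integral_left (by fun_prop : Continuous fun s => (T - s) * f s) T t
  refine ((h1.const_mul (-1 / T)).add (h2.const_mul (1 / T))).congr_deriv ?_
  field_simp
  ring

lemma continuous_dirichletSolution (hT : 0 < T) (hf : Continuous f) :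
    Continuous (dirichletSolution T f) :=
  continuous_iff_continuousAt.2 fun t => (hasDerivAt_dirichletSolution hT hf t).continuousAt

lemma continuous_dirichletSolutionDeriv (hT : 0 < T) (hf : Continuous f) :
    Continuous (dirichletSolutionDeriv T f) :=
  continuous_iff_continuousAt.2 fun t => (hasDerivAt_dirichletSolutionDeriv hT hf t).continuousAt

@[simp] lemma dirichletSolution_zero : dirichletSolution T f 0 = 0 := by
  simp [dirichletSolution]

@[simp] lemma dirichletSolution_right : dirichletSolution T f T = 0 := by
  simp [dirichletSolution]

/-- Symmetry of the Green operator: integration by parts turns both sides into the integral of the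
product of the derivatives. -/
lemma integral_mul_dirichletSolution_comm {h : ℝ → ℝ} (hT : 0 < T) (hf : Continuous f)
    (hh : Continuous h) :
    ∫ t in (0 : ℝ)..T, h t * dirichletSolution T f t =
      ∫ t in (0 : ℝ)..T, f t * dirichletSolution T h t := by
  have key : ∀ f h : ℝ → ℝ, Continuous f → Continuous h →
      ∫ t in (0 : ℝ)..T, h t * dirichletSolution T f t =
      ∫ t in (0 : ℝ)..T, dirichletSolutionDeriv T f t * dirichletSolutionDeriv T h t := by
    intro f h hf hh
    have := intervalIntegral.integral_mul_deriv_eq_deriv_mul (a := 0) (b := T)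
      (u := dirichletSolution T f) (v := dirichletSolutionDeriv T h)
      (fun t _ => hasDerivAt_dirichletSolution hT hf t)
      (fun t _ => hasDerivAt_dirichletSolutionDeriv hT hh t)
      ((continuous_dirichletSolutionDeriv hT hf).intervalIntegrable _ _)
      (hh.neg.intervalIntegrable _ _)
    simp only [dirichletSolution_zero, dirichletSolution_right, zero_mul, sub_zero, zero_sub,
      mul_neg, intervalIntegral.integral_neg, neg_inj] at this
    simpa only [mul_comm (h _)] using this
  rw [key f h hf hh, key h f hh hf]
  simp only [mul_comm]

lemma dirichletSolution_nonneg (hT : 0 < T) (hf0 : ∀ t ∈ Icc 0 T, 0 ≤ f t) {t : ℝ}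
    (ht : t ∈ Icc 0 T) : 0 ≤ dirichletSolution T f t := by
  have h1 : 0 ≤ ∫ s in (0 : ℝ)..t, s * f s := intervalIntegral.integral_nonneg ht.1
    fun s hs => mul_nonneg hs.1 (hf0 s ⟨hs.1, hs.2.trans ht.2⟩)
  have h2 : 0 ≤ ∫ s in t..T, (T - s) * f s := intervalIntegral.integral_nonneg ht.2
    fun s hs => mul_nonneg (sub_nonneg.2 hs.2) (hf0 s ⟨ht.1.trans hs.1, hs.2⟩)
  have h3 : 0 ≤ T - t := sub_nonneg.2 ht.2
  have := ht.1
  unfold dirichletSolution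
  positivity

lemma dirichletSolution_pos (hT : 0 < T) (hf : Continuous f) (hf0 : ∀ t ∈ Icc 0 T, 0 ≤ f t)
    (hpos : ∃ x ∈ Ioo 0 T, 0 < f x) {t : ℝ} (ht : t ∈ Ioo 0 T) : 0 < dirichletSolution T f t := by
  have h1 : 0 ≤ ∫ s in (0 : ℝ)..t, s * f s := intervalIntegral.integral_nonneg ht.1.le
    fun s hs => mul_nonneg hs.1 (hf0 s ⟨hs.1, hs.2.trans ht.2.le⟩)
  have h2 : 0 ≤ ∫ s in t..T, (T - s) * f s := intervalIntegral.integral_nonneg ht.2.le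
    fun s hs => mul_nonneg (sub_nonneg.2 hs.2) (hf0 s ⟨ht.1.le.trans hs.1, hs.2⟩)
  have h3 : 0 < T - t := sub_pos.2 ht.2
  have h4 := ht.1
  obtain ⟨x, hx, hfx⟩ := hpos
  unfold dirichletSolution
  rcases le_total x t with hxt | hxt
  · have : 0 < ∫ s in (0 : ℝ)..t, s * f s := intervalIntegral.integral_pos ht.1
      (by fun_prop) (fun s hs => mul_nonneg hs.1.le (hf0 s ⟨hs.1.le, hs.2.trans ht.2.le⟩))
      ⟨x, ⟨hx.1.le, hxt⟩, mul_pos hx.1 hfx⟩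
    positivity
  · have : 0 < ∫ s in t..T, (T - s) * f s := intervalIntegral.integral_pos ht.2
      (by fun_prop)
      (fun s hs => mul_nonneg (sub_nonneg.2 hs.2) (hf0 s ⟨ht.1.le.trans hs.1.le, hs.2⟩))
      ⟨x, ⟨hxt, hx.2.le⟩, mul_pos (sub_pos.2 hx.2) hfx⟩
    positivity

/-- The kernel weights `s / T` and `(T - s) / T` are at most one. This supplies the equicontinuity
for Arzelà–Ascoli. -/
lemma abs_dirichletSolutionDeriv_le (hT : 0 < T) (hf : Continuous f)
    (hf0 : ∀ t ∈ Icc 0 T, 0 ≤ f t) {t : ℝ} (ht : t ∈ Icc 0 T) :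
    |dirichletSolutionDeriv T f t| ≤ ∫ s in (0 : ℝ)..T, f s := by
  have h1 : 0 ≤ ∫ s in (0 : ℝ)..t, s * f s := intervalIntegral.integral_nonneg ht.1
    fun s hs => mul_nonneg hs.1 (hf0 s ⟨hs.1, hs.2.trans ht.2⟩)
  have h2 : 0 ≤ ∫ s in t..T, (T - s) * f s := intervalIntegral.integral_nonneg ht.2
    fun s hs => mul_nonneg (sub_nonneg.2 hs.2) (hf0 s ⟨ht.1.trans hs.1, hs.2⟩)
  have h3 : ∫ s in (0 : ℝ)..t, s * f s ≤ ∫ s in (0 : ℝ)..t, T * f s :=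
    intervalIntegral.integral_mono_on ht.1
      ((by fun_prop : Continuous fun s => s * f s).intervalIntegrable _ _)
      ((by fun_prop : Continuous fun s => T * f s).intervalIntegrable _ _)
      fun s hs => mul_le_mul_of_nonneg_right (hs.2.trans ht.2) (hf0 s ⟨hs.1, hs.2.trans ht.2⟩)
  have h4 : ∫ s in t..T, (T - s) * f s ≤ ∫ s in t..T, T * f s :=
    intervalIntegral.integral_mono_on ht.2
      ((by fun_prop : Continuous fun s => (T - s) * f s).intervalIntegrable _ _)
      ((by fun_prop : Continuous fun s => T * f s).intervalIntegrable _ _)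
      fun s hs => mul_le_mul_of_nonneg_right (by linarith [ht.1, hs.1])
        (hf0 s ⟨ht.1.trans hs.1, hs.2⟩)
  have h5 : (∫ s in (0 : ℝ)..t, f s) + ∫ s in t..T, f s = ∫ s in (0 : ℝ)..T, f s :=
    intervalIntegral.integral_add_adjacent_intervals (hf.intervalIntegrable _ _)
      (hf.intervalIntegrable _ _)
  rw [intervalIntegral.integral_const_mul] at h3 h4
  have h6 : |dirichletSolutionDeriv T f t| ≤
      ((∫ s in (0 : ℝ)..t, s * f s) + ∫ s in t..T, (T - s) * f s) / T := by
    rw [dirichletSolutionDeriv, abs_le]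
    constructor <;> field_simp <;> linarith
  refine h6.trans ?_
  rw [div_le_iff₀ hT, ← h5]
  linarith

lemma abs_dirichletSolution_sub_le (hT : 0 < T) (hf : Continuous f)
    (hf0 : ∀ t ∈ Icc 0 T, 0 ≤ f t) {s t : ℝ} (hs : s ∈ Icc 0 T) (ht : t ∈ Icc 0 T) :
    |dirichletSolution T f t - dirichletSolution T f s| ≤ (∫ x in (0 : ℝ)..T, f x) * |t - s| :=
  Convex.norm_image_sub_le_of_norm_hasDerivWithin_le
    (fun x _ => (hasDerivAt_dirichletSolution hT hf x).hasDerivWithinAt)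
    (fun _ hx => abs_dirichletSolutionDeriv_le hT hf hf0 hx) (convex_Icc 0 T) hs ht

end Dirichlet

/-! ### Young's inequality with its equality case -/

/-- Strict Bernoulli inequality at `y / x`, multiplied by `x ^ r`. The strictness later identifies
the limit of a maximising sequence. -/
lemma rpow_sub_one_mul_lt_of_ne {r x y : ℝ} (hr : 1 < r) (hx : 0 ≤ x) (hy : 0 ≤ y) (hne : x ≠ y) :
    x ^ (r - 1) * y < (1 - 1 / r) * x ^ r + 1 / r * y ^ r := by
  have hr0 : 0 < r := by linarith
  rcases hx.eq_or_lt with rfl | hx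
  · rw [Real.zero_rpow (by linarith), Real.zero_rpow hr0.ne']
    have : 0 < y := lt_of_le_of_ne hy hne
    simp only [zero_mul, mul_zero, zero_add]
    positivity
  · have h1 := one_add_mul_self_lt_rpow_one_add (s := y / x - 1)
      (by have : 0 ≤ y / x := by positivity
          linarith)
      (by rw [sub_ne_zero, Ne, div_eq_one_iff_eq hx.ne']; exact hne.symm) hr
    rw [add_sub_cancel, Real.div_rpow hy hx.le, lt_div_iff₀ (by positivity)] at h1
    rw [Real.rpow_sub_one hx.ne']
    have h2 : (1 + r * (y / x - 1)) * x ^ r = x ^ r - r * x ^ r + r * (x ^ r / x * y) := by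
      field_simp
      ring
    rw [h2] at h1
    have h3 : r * (x ^ r / x * y) < r * ((1 - 1 / r) * x ^ r + 1 / r * y ^ r) := by
      have : r * ((1 - 1 / r) * x ^ r + 1 / r * y ^ r) = r * x ^ r - x ^ r + y ^ r := by
        field_simp
      rw [this]
      linarith
    exact lt_of_mul_lt_mul_left h3 hr0.le

lemma rpow_sub_one_mul_self {r x : ℝ} (hr : 1 < r) (hx : 0 ≤ x) : x ^ (r - 1) * x = x ^ r := by
  rcases hx.eq_or_lt with rfl | hx
  · rw [mul_zero, Real.zero_rpow (by linarith)]
  · rw [Real.rpow_sub_one hx.ne', div_mul_cancel₀ _ hx.ne']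

lemma rpow_sub_one_mul_le {r x y : ℝ} (hr : 1 < r) (hx : 0 ≤ x) (hy : 0 ≤ y) :
    x ^ (r - 1) * y ≤ (1 - 1 / r) * x ^ r + 1 / r * y ^ r := by
  by_cases h : x = y
  · rw [← h, rpow_sub_one_mul_self hr hx]
    linarith
  · exact (rpow_sub_one_mul_lt_of_ne hr hx hy h).le

lemma le_one_add_rpow {r x : ℝ} (hr : 1 < r) (hx : 0 ≤ x) : x ≤ 1 + x ^ r := by
  rcases le_total x 1 with h | h
  · have := Real.rpow_nonneg hx r
    linarith
  · have := Real.rpow_le_rpow_of_exponent_le h hr.le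
    rw [Real.rpow_one] at this
    linarith

/-! ### Existence by maximisation -/

/-- Continuous functions that are nonnegative on `[0, T]` and have `L^p`-norm at most one there. -/
def admissibleSet (p T : ℝ) : Set (ℝ → ℝ) :=
  {f | Continuous f ∧ (∀ t ∈ Icc 0 T, 0 ≤ f t) ∧ ∫ t in (0 : ℝ)..T, f t ^ p ≤ 1}

/-- The functional `f ↦ ∫ (G f) ^ q` with `G` the Dirichlet solution operator. -/
noncomputable def solutionEnergy (q T : ℝ) (f : ℝ → ℝ) : ℝ :=
  ∫ t in (0 : ℝ)..T, dirichletSolution T f t ^ q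

section Existence

open Filter Topology

variable {p q T : ℝ}

lemma integral_le_of_mem_admissibleSet (hp : 1 < p) (hT : 0 < T) {f : ℝ → ℝ}
    (hf : f ∈ admissibleSet p T) : ∫ t in (0 : ℝ)..T, f t ≤ T + 1 := by
  have hc : Continuous fun t => f t ^ p := hf.1.rpow_const fun _ => Or.inr (by linarith)
  have h1 : ∫ t in (0 : ℝ)..T, f t ≤ ∫ t in (0 : ℝ)..T, (1 + f t ^ p) :=
    intervalIntegral.integral_mono_on hT.le (hf.1.intervalIntegrable _ _)
      ((continuous_const.add hc).intervalIntegrable _ _)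
      fun t ht => le_one_add_rpow hp (hf.2.1 t ht)
  rw [intervalIntegral.integral_add (continuous_const.intervalIntegrable _ _)
    (hc.intervalIntegrable _ _), intervalIntegral.integral_const] at h1
  have := hf.2.2
  simp only [sub_zero, smul_eq_mul, mul_one] at h1
  linarith

lemma dirichletSolution_le_of_mem_admissibleSet (hp : 1 < p) (hT : 0 < T) {f : ℝ → ℝ}
    (hf : f ∈ admissibleSet p T) {t : ℝ} (ht : t ∈ Icc 0 T) :
    dirichletSolution T f t ≤ (T + 1) * T := by
  have h1 := abs_dirichletSolution_sub_le hT hf.1 hf.2.1 (left_mem_Icc.2 hT.le) ht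
  rw [dirichletSolution_zero, sub_zero, sub_zero, abs_of_nonneg ht.1] at h1
  exact (le_abs_self _).trans (h1.trans (mul_le_mul (integral_le_of_mem_admissibleSet hp hT hf)
    ht.2 ht.1 (by linarith)))

lemma solutionEnergy_le (hp : 1 < p) (hq : 1 < q) (hT : 0 < T) {f : ℝ → ℝ}
    (hf : f ∈ admissibleSet p T) : solutionEnergy q T f ≤ T * ((T + 1) * T) ^ q := by
  have h1 : solutionEnergy q T f ≤ ∫ _ in (0 : ℝ)..T, ((T + 1) * T) ^ q :=
    intervalIntegral.integral_mono_on hT.le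
      (((continuous_dirichletSolution hT hf.1).rpow_const
        fun _ => Or.inr (by linarith)).intervalIntegrable _ _)
      (continuous_const.intervalIntegrable _ _)
      fun t ht => Real.rpow_le_rpow (dirichletSolution_nonneg hT hf.2.1 ht)
        (dirichletSolution_le_of_mem_admissibleSet hp hT hf ht) (by linarith)
  simpa using h1

/-- The constant of norm one is a competitor; a positive supremum prevents the limit from vanishing.
-/
lemma exists_mem_admissibleSet_pos (hp : 1 < p) (hq : 1 < q) (hT : 0 < T) :
    ∃ f ∈ admissibleSet p T, 0 < solutionEnergy q T f := by
  have hk : 0 < T ^ (-(1 / p)) := by positivity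
  refine ⟨fun _ => T ^ (-(1 / p)), ⟨continuous_const, fun _ _ => hk.le, ?_⟩, ?_⟩
  · rw [intervalIntegral.integral_const, ← Real.rpow_mul hT.le, neg_mul,
      one_div_mul_cancel (by linarith), Real.rpow_neg_one]
    simp [hT.ne']
  · refine intervalIntegral.integral_pos hT
      ((continuous_dirichletSolution hT continuous_const).rpow_const
        fun _ => Or.inr (by linarith)).continuousOn
      (fun t ht => Real.rpow_nonneg (dirichletSolution_nonneg hT (fun _ _ => hk.le)
        (Ioc_subset_Icc_self ht)) _) ⟨T / 2, ⟨by linarith, by linarith⟩, ?_⟩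
    exact Real.rpow_pos_of_pos (dirichletSolution_pos hT continuous_const (fun _ _ => hk.le)
      ⟨T / 2, ⟨by linarith, by linarith⟩, hk⟩ ⟨by linarith, by linarith⟩) _

/-- Images of admissible functions under the Dirichlet solution operator are sequentially
relatively compact. -/
lemma exists_subseq_tendsto_dirichletSolution (hp : 1 < p) (hT : 0 < T) (F : ℕ → ℝ → ℝ)
    (hF : ∀ n, F n ∈ admissibleSet p T) :
    ∃ (u : ℝ → ℝ) (φ : ℕ → ℕ), Continuous u ∧ StrictMono φ ∧
      ∀ t ∈ Icc 0 T, Tendsto (fun n => dirichletSolution T (F (φ n)) t) atTop (𝓝 (u t)) := by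
  let U : ℕ → BoundedContinuousFunction (Icc (0 : ℝ) T) ℝ := fun n =>
    BoundedContinuousFunction.mkOfCompact
      ⟨fun t => dirichletSolution T (F n) t,
        (continuous_dirichletSolution hT (hF n).1).comp continuous_subtype_val⟩
  have hcomp : IsCompact (closure (range U)) := by
    refine BoundedContinuousFunction.arzela_ascoli (Icc 0 ((T + 1) * T)) isCompact_Icc _ ?_ ?_
    · rintro _ t ⟨n, rfl⟩
      exact ⟨dirichletSolution_nonneg hT (hF n).2.1 t.2,
        dirichletSolution_le_of_mem_admissibleSet hp hT (hF n) t.2⟩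
    · refine (LipschitzWith.uniformEquicontinuous _ (T + 1).toNNReal ?_).equicontinuous
      rintro ⟨_, n, rfl⟩
      refine LipschitzWith.of_dist_le_mul fun s t => ?_
      rw [Real.coe_toNNReal _ (by linarith)]
      refine (abs_dirichletSolution_sub_le hT (hF n).1 (hF n).2.1 t.2 s.2).trans ?_
      exact mul_le_mul_of_nonneg_right (integral_le_of_mem_admissibleSet hp hT (hF n))
        (abs_nonneg _)
  obtain ⟨V, -, φ, hφ, hV⟩ := hcomp.tendsto_subseq (fun n => subset_closure (mem_range_self n))
  refine ⟨IccExtend hT.le V, φ, V.continuous.Icc_extend', hφ, fun t ht => ?_⟩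
  rw [IccExtend_of_mem hT.le V ht]
  exact (BoundedContinuousFunction.tendsto_iff_tendstoUniformly.1 hV).tendsto_at ⟨t, ht⟩

/-- The nonlinear eigenvalue problem `u = G f`, `f = c (G u^(q-1))^(1/(p-1))` has a solution. -/
lemma exists_dirichletSolution_fixed (hp : 1 < p) (hq : 1 < q) (hT : 0 < T) :
    ∃ (c : ℝ) (u : ℝ → ℝ), 0 < c ∧ Continuous u ∧ (∀ t ∈ Icc 0 T, 0 ≤ u t) ∧
      (∃ x ∈ Ioo 0 T, 0 < u x) ∧
      ∀ t ∈ Icc 0 T, u t = dirichletSolution T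
        (fun s => c * dirichletSolution T (fun x => u x ^ (q - 1)) s ^ (1 / (p - 1))) t := by
  have hp0 : 0 < p := by linarith
  have hq0 : 0 < q := by linarith
  have hp1 : 0 < p - 1 := by linarith
  obtain ⟨k, hk, hkpos⟩ := exists_mem_admissibleSet_pos hp hq hT
  have hbdd : BddAbove (solutionEnergy q T '' admissibleSet p T) :=
    ⟨_, forall_mem_image.2 fun f hf => solutionEnergy_le hp hq hT hf⟩
  obtain ⟨m, -, hm, hmem⟩ := exists_seq_tendsto_sSup ⟨_, mem_image_of_mem _ hk⟩ hbdd
  set M := sSup (solutionEnergy q T '' admissibleSet p T)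
  have hMpos : 0 < M := hkpos.trans_le (le_csSup hbdd (mem_image_of_mem _ hk))
  choose F hF hFm using hmem
  obtain ⟨u, φ, hu, hφ, hlim⟩ := exists_subseq_tendsto_dirichletSolution hp hT F hF
  have hu0 : ∀ t ∈ Icc 0 T, 0 ≤ u t := fun t ht =>
    ge_of_tendsto' (hlim t ht) fun n => dirichletSolution_nonneg hT (hF _).2.1 ht
  have huIoc : ∀ t ∈ uIoc 0 T, t ∈ Icc 0 T := fun t ht => by
    rw [uIoc_of_le hT.le] at ht
    exact Ioc_subset_Icc_self ht
  have huq : Continuous fun t => u t ^ q := hu.rpow_const fun _ => Or.inr hq0.le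
  have huq1 : Continuous fun t => u t ^ (q - 1) := hu.rpow_const fun _ => Or.inr (by linarith)
  have huq10 : ∀ t ∈ Icc 0 T, 0 ≤ u t ^ (q - 1) := fun t ht => Real.rpow_nonneg (hu0 t ht) _
  -- the limit attains the supremum
  have hM : M = ∫ t in (0 : ℝ)..T, u t ^ q := by
    refine tendsto_nhds_unique (hm.comp hφ.tendsto_atTop) ?_
    have : (m ∘ φ) = fun n => ∫ t in (0 : ℝ)..T, dirichletSolution T (F (φ n)) t ^ q :=
      funext fun n => (hFm (φ n)).symm
    rw [this]
    refine intervalIntegral.tendsto_integral_filter_of_dominated_convergence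
      (fun _ => ((T + 1) * T) ^ q) (.of_forall fun n => ?_) (.of_forall fun n => ?_)
      (continuous_const.intervalIntegrable _ _) (.of_forall fun t ht => ?_)
    · exact ((continuous_dirichletSolution hT (hF _).1).rpow_const
        fun _ => Or.inr hq0.le).aestronglyMeasurable
    · refine .of_forall fun t ht => ?_
      have h0 := dirichletSolution_nonneg hT (hF (φ n)).2.1 (huIoc t ht)
      rw [Real.norm_eq_abs, abs_of_nonneg (Real.rpow_nonneg h0 _)]
      exact Real.rpow_le_rpow h0
        (dirichletSolution_le_of_mem_admissibleSet hp hT (hF _) (huIoc t ht)) hq0.le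
    · exact (hlim t (huIoc t ht)).rpow_const (Or.inr hq0.le)
  set g := dirichletSolution T (fun x => u x ^ (q - 1)) with hg
  have hgc : Continuous g := continuous_dirichletSolution hT huq1
  have hg0 : ∀ t ∈ Icc 0 T, 0 ≤ g t := fun t ht => dirichletSolution_nonneg hT huq10 ht
  -- By symmetry of `G` the integrals equal `∫ u^(q-1) G(F (φ n))`. No limit of the `F (φ n)`
  -- themselves is needed.
  have hM' : Tendsto (fun n => ∫ t in (0 : ℝ)..T, F (φ n) t * g t) atTop (𝓝 M) := by
    have h1 : (fun n => ∫ t in (0 : ℝ)..T, F (φ n) t * g t) =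
        fun n => ∫ t in (0 : ℝ)..T, u t ^ (q - 1) * dirichletSolution T (F (φ n)) t :=
      funext fun n => (integral_mul_dirichletSolution_comm hT (hF _).1 huq1).symm
    have h2 : M = ∫ t in (0 : ℝ)..T, u t ^ (q - 1) * u t := by
      rw [hM]
      refine intervalIntegral.integral_congr fun t ht => ?_
      rw [uIcc_of_le hT.le] at ht
      exact (rpow_sub_one_mul_self hq (hu0 t ht)).symm
    rw [h1, h2]
    refine intervalIntegral.tendsto_integral_filter_of_dominated_convergence
      (fun t => u t ^ (q - 1) * ((T + 1) * T)) (.of_forall fun n => ?_) (.of_forall fun n => ?_)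
      ((huq1.mul continuous_const).intervalIntegrable _ _) (.of_forall fun t ht => ?_)
    · exact (huq1.mul (continuous_dirichletSolution hT (hF _).1)).aestronglyMeasurable
    · refine .of_forall fun t ht => ?_
      have h0 := dirichletSolution_nonneg hT (hF (φ n)).2.1 (huIoc t ht)
      have h3 := huq10 t (huIoc t ht)
      rw [Real.norm_eq_abs, abs_of_nonneg (mul_nonneg h3 h0)]
      exact mul_le_mul_of_nonneg_left
        (dirichletSolution_le_of_mem_admissibleSet hp hT (hF _) (huIoc t ht)) h3
    · exact (hlim t (huIoc t ht)).const_mul _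
  have hupos : ∃ x ∈ Ioo 0 T, 0 < u x := by
    by_contra! hcon
    have hz : ∀ t ∈ Ioo 0 T, u t ^ q = 0 := fun t ht => by
      rw [le_antisymm (hcon t ht) (hu0 t (Ioo_subset_Icc_self ht)), Real.zero_rpow hq0.ne']
    have : M = ∫ _ in (0 : ℝ)..T, (0 : ℝ) := by
      rw [hM]
      refine intervalIntegral.integral_congr_ae ?_
      have hne : ∀ᵐ t : ℝ, t ≠ T := by simp [MeasureTheory.ae_iff]
      filter_upwards [hne] with t htT ht
      rw [uIoc_of_le hT.le] at ht
      exact hz t ⟨ht.1, lt_of_le_of_ne ht.2 htT⟩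
    simp only [intervalIntegral.integral_zero] at this
    linarith
  have hgpos : ∀ t ∈ Ioo 0 T, 0 < g t := fun t ht => dirichletSolution_pos hT huq1 huq10
    (by obtain ⟨x, hx, hux⟩ := hupos; exact ⟨x, hx, Real.rpow_pos_of_pos hux _⟩) ht
  set a := 1 / (p - 1) with ha
  have ha0 : 0 < a := by positivity
  have hgap : Continuous fun t => g t ^ (a * p) := hgc.rpow_const fun _ => Or.inr (by positivity)
  have hI : 0 < ∫ t in (0 : ℝ)..T, g t ^ (a * p) :=
    intervalIntegral.integral_pos hT hgap.continuousOn
      (fun t ht => Real.rpow_nonneg (hg0 t (Ioc_subset_Icc_self ht)) _)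
      ⟨T / 2, ⟨by linarith, by linarith⟩,
        Real.rpow_pos_of_pos (hgpos _ ⟨by linarith, by linarith⟩) _⟩
  set I := ∫ t in (0 : ℝ)..T, g t ^ (a * p) with hIdef
  set c := I ^ (-(1 / p)) with hc
  have hc0 : 0 < c := by positivity
  have hcp : c ^ p * I = 1 := by
    rw [hc, ← Real.rpow_mul hI.le, neg_mul, one_div_mul_cancel hp0.ne', Real.rpow_neg_one,
      inv_mul_cancel₀ hI.ne']
  -- Equality case of Hölder: `f` maximises `∫ f g` on the admissible set, with `c` normalising `∫
  -- f^p` to one.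
  set f := fun s => c * g s ^ a with hf
  have hfc : Continuous f := continuous_const.mul (hgc.rpow_const fun _ => Or.inr ha0.le)
  have hf0 : ∀ t ∈ Icc 0 T, 0 ≤ f t := fun t ht => mul_nonneg hc0.le (Real.rpow_nonneg (hg0 t ht) _)
  have hfpc : Continuous fun t => f t ^ p := hfc.rpow_const fun _ => Or.inr hp0.le
  have hfp : ∫ t in (0 : ℝ)..T, f t ^ p = 1 := by
    rw [← hcp, hIdef, ← intervalIntegral.integral_const_mul]
    refine intervalIntegral.integral_congr fun t ht => ?_
    rw [uIcc_of_le hT.le] at ht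
    simp only [hf]
    rw [Real.mul_rpow hc0.le (Real.rpow_nonneg (hg0 t ht) _), ← Real.rpow_mul (hg0 t ht)]
  have hfS : f ∈ admissibleSet p T := ⟨hfc, hf0, hfp.le⟩
  have hfg : ∀ t ∈ Icc 0 T, f t ^ (p - 1) = c ^ (p - 1) * g t := fun t ht => by
    simp only [hf]
    rw [Real.mul_rpow hc0.le (Real.rpow_nonneg (hg0 t ht) _), ← Real.rpow_mul (hg0 t ht), ha,
      one_div_mul_cancel hp1.ne', Real.rpow_one]
  have hcp1 : 0 < c ^ (p - 1) := by positivity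
  have hint : ∀ h : ℝ → ℝ, c ^ (p - 1) * ∫ t in (0 : ℝ)..T, h t * g t =
      ∫ t in (0 : ℝ)..T, f t ^ (p - 1) * h t := fun h => by
    rw [← intervalIntegral.integral_const_mul]
    refine intervalIntegral.integral_congr fun t ht => ?_
    rw [uIcc_of_le hT.le] at ht
    simp only [hfg t ht]
    ring
  have hfp1 : Continuous fun t => f t ^ (p - 1) := hfc.rpow_const fun _ => Or.inr hp1.le
  have hle : ∀ n, c ^ (p - 1) * ∫ t in (0 : ℝ)..T, F (φ n) t * g t ≤ 1 := fun n => by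
    have hFn := hF (φ n)
    have hFp : Continuous fun t => F (φ n) t ^ p := hFn.1.rpow_const fun _ => Or.inr hp0.le
    rw [hint]
    have h1 : ∫ t in (0 : ℝ)..T, f t ^ (p - 1) * F (φ n) t ≤
        ∫ t in (0 : ℝ)..T, ((1 - 1 / p) * f t ^ p + 1 / p * F (φ n) t ^ p) :=
      intervalIntegral.integral_mono_on hT.le ((hfp1.mul hFn.1).intervalIntegrable _ _)
        (((hfpc.const_mul _).add (hFp.const_mul _)).intervalIntegrable _ _)
        fun t ht => rpow_sub_one_mul_le hp (hf0 t ht) (hFn.2.1 t ht)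
    rw [intervalIntegral.integral_add ((hfpc.const_mul _).intervalIntegrable _ _)
      ((hFp.const_mul _).intervalIntegrable _ _), intervalIntegral.integral_const_mul,
      intervalIntegral.integral_const_mul, hfp] at h1
    have h2 : 1 / p * ∫ t in (0 : ℝ)..T, F (φ n) t ^ p ≤ 1 / p * 1 :=
      mul_le_mul_of_nonneg_left hFn.2.2 (by positivity)
    linarith
  have hMle : c ^ (p - 1) * M ≤ 1 := le_of_tendsto' (hM'.const_mul _) hle
  have hfgint : c ^ (p - 1) * ∫ t in (0 : ℝ)..T, f t * g t = 1 := by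
    rw [hint]
    refine Eq.trans (intervalIntegral.integral_congr fun t ht => ?_) hfp
    rw [uIcc_of_le hT.le] at ht
    exact rpow_sub_one_mul_self hp (hf0 t ht)
  have hMle' : M ≤ ∫ t in (0 : ℝ)..T, u t ^ (q - 1) * dirichletSolution T f t := by
    rw [integral_mul_dirichletSolution_comm hT hfc huq1]
    exact le_of_mul_le_mul_left (hMle.trans hfgint.ge) hcp1
  have hJ : solutionEnergy q T f ≤ M := le_csSup hbdd (mem_image_of_mem _ hfS)
  have hGc : Continuous (dirichletSolution T f) := continuous_dirichletSolution hT hfc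
  have hGq : Continuous fun t => dirichletSolution T f t ^ q :=
    hGc.rpow_const fun _ => Or.inr hq0.le
  refine ⟨c, u, hc0, hu, hu0, hupos, ?_⟩
  -- The chain `M ≤ ∫ f g = ∫ u^(q-1) G f ≤ (1 - 1/q) ∫ u^q + (1/q) ∫ (G f)^q ≤ M` must consist of
  -- equalities; if `u ≠ G f` at one point, Young's inequality makes it strict.
  by_contra! hcon
  obtain ⟨x, hx, hne⟩ := hcon
  have hpos : 0 < ∫ t in (0 : ℝ)..T, ((1 - 1 / q) * u t ^ q + 1 / q * dirichletSolution T f t ^ q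
      - u t ^ (q - 1) * dirichletSolution T f t) :=
    intervalIntegral.integral_pos hT
      (((huq.const_mul _).add (hGq.const_mul _)).sub (huq1.mul hGc)).continuousOn
      (fun t ht => sub_nonneg.2 (rpow_sub_one_mul_le hq (hu0 t (Ioc_subset_Icc_self ht))
        (dirichletSolution_nonneg hT hf0 (Ioc_subset_Icc_self ht))))
      ⟨x, hx, sub_pos.2 (rpow_sub_one_mul_lt_of_ne hq (hu0 x hx)
        (dirichletSolution_nonneg hT hf0 hx) hne)⟩
  have hsum : Continuous fun t => (1 - 1 / q) * u t ^ q + 1 / q * dirichletSolution T f t ^ q :=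
    (huq.const_mul _).add (hGq.const_mul _)
  have hprod : Continuous fun t => u t ^ (q - 1) * dirichletSolution T f t := huq1.mul hGc
  rw [intervalIntegral.integral_sub (hsum.intervalIntegrable _ _) (hprod.intervalIntegrable _ _),
    intervalIntegral.integral_add ((huq.const_mul _).intervalIntegrable _ _)
      ((hGq.const_mul _).intervalIntegrable _ _), intervalIntegral.integral_const_mul,
    intervalIntegral.integral_const_mul, ← hM] at hpos
  have h1 : 1 / q * (∫ t in (0 : ℝ)..T, dirichletSolution T f t ^ q) ≤ 1 / q * M :=
    mul_le_mul_of_nonneg_left hJ (by positivity)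
  linarith

/-- For some parameter there is a Lane–Emden pair vanishing at both ends. -/
theorem LaneEmdenPair.exists_dirichlet (hp : 1 < p) (hq : 1 < q) (hT : 0 < T) :
    ∃ (lam : ℝ) (u u₁ w w₁ : ℝ → ℝ), 0 < lam ∧
      LaneEmdenPair (1 / (p - 1)) (q - 1) lam T u u₁ w w₁ ∧ u T = 0 ∧ w T = 0 := by
  have hp1 : 0 < p - 1 := by linarith
  obtain ⟨c, u, hc, hu, hu0, hupos, heq⟩ := exists_dirichletSolution_fixed hp hq hT
  have huq1 : Continuous fun t => u t ^ (q - 1) := hu.rpow_const fun _ => Or.inr (by linarith)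
  have huq10 : ∀ t ∈ Icc 0 T, 0 ≤ u t ^ (q - 1) := fun t ht => Real.rpow_nonneg (hu0 t ht) _
  set g := dirichletSolution T (fun x => u x ^ (q - 1)) with hg
  have hgc : Continuous g := continuous_dirichletSolution hT huq1
  have hg0 : ∀ t ∈ Icc 0 T, 0 ≤ g t := fun t ht => dirichletSolution_nonneg hT huq10 ht
  have hgpos : ∀ t ∈ Ioo 0 T, 0 < g t := fun t ht => dirichletSolution_pos hT huq1 huq10
    (by obtain ⟨x, hx, hux⟩ := hupos; exact ⟨x, hx, Real.rpow_pos_of_pos hux _⟩) ht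
  set f := fun s => c * g s ^ (1 / (p - 1)) with hf
  have hfc : Continuous f :=
    continuous_const.mul (hgc.rpow_const fun _ => Or.inr (by positivity))
  have hf0 : ∀ t ∈ Icc 0 T, 0 ≤ f t := fun t ht =>
    mul_nonneg hc.le (Real.rpow_nonneg (hg0 t ht) _)
  have hB : 0 < c ^ (p - 1) := by positivity
  -- Taking `w = c^(p-1) g` gives `w^(1/(p-1)) = f`, and `-w'' = c^(p-1) u^(q-1)` makes `c^(p-1)`
  -- the parameter.
  refine ⟨c ^ (p - 1), dirichletSolution T f, dirichletSolutionDeriv T f,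
    fun t => c ^ (p - 1) * g t,
    fun t => c ^ (p - 1) * dirichletSolutionDeriv T (fun x => u x ^ (q - 1)) t, hB,
    ⟨fun t _ => (hasDerivAt_dirichletSolution hT hfc t).hasDerivWithinAt, fun t ht => ?_,
      fun t _ => ((hasDerivAt_dirichletSolution hT huq1 t).const_mul _).hasDerivWithinAt,
      fun t ht => ?_, dirichletSolution_zero, by simp [hg], fun t ht => ?_,
      fun t ht => mul_pos hB (hgpos t ht)⟩, dirichletSolution_right, by simp [hg]⟩
  · refine (hasDerivAt_dirichletSolutionDeriv hT hfc t).hasDerivWithinAt.congr_deriv ?_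
    rw [Real.mul_rpow hB.le (hg0 t ht), ← Real.rpow_mul hc.le, mul_one_div_cancel hp1.ne',
      Real.rpow_one]
  · refine ((hasDerivAt_dirichletSolutionDeriv hT huq1 t).const_mul _).hasDerivWithinAt.congr_deriv
      ?_
    rw [← heq t ht, mul_neg]
  · exact dirichletSolution_pos hT hfc hf0 ⟨t, ht, mul_pos hc
      (Real.rpow_pos_of_pos (hgpos t ht) _)⟩ ht

end Existence

/-! ### Positive Navier solutions and Lane–Emden pairs -/

lemma signedPow_neg_rpow {p w : ℝ} (hp : 1 < p) (hw : 0 ≤ w) :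
    signedPow p (-w ^ (1 / (p - 1))) = -w := by
  have hp1 : 0 < p - 1 := by linarith
  rcases hw.eq_or_lt with rfl | hw
  · rw [Real.zero_rpow (by positivity)]
    simp [signedPow]
  · have h : 0 < w ^ (1 / (p - 1)) := by positivity
    rw [signedPow, abs_neg, abs_of_pos h, mul_neg, neg_inj, ← Real.rpow_add_one h.ne',
      ← Real.rpow_mul hw.le, show p - 2 + 1 = p - 1 by ring, one_div_mul_cancel hp1.ne',
      Real.rpow_one]

lemma signedPow_of_nonneg {q x : ℝ} (hq : 1 < q) (hx : 0 ≤ x) : signedPow q x = x ^ (q - 1) := by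
  rcases hx.eq_or_lt with rfl | hx
  · rw [Real.zero_rpow (by linarith)]
    simp [signedPow]
  · rw [signedPow, abs_of_pos hx, ← Real.rpow_add_one hx.ne']
    congr 1
    ring

lemma eq_neg_rpow_of_signedPow_eq {p w y : ℝ} (hp : 1 < p) (hw : 0 ≤ w)
    (h : signedPow p y = -w) : y = -w ^ (1 / (p - 1)) := by
  have hp1 : 0 < p - 1 := by linarith
  have hy : y ≤ 0 := by
    by_contra! hy
    have : 0 < signedPow p y := by
      rw [signedPow, abs_of_pos hy]
      positivity
    linarith
  have h1 : signedPow p y = -(-y) ^ (p - 1) := by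
    rw [← signedPow_of_nonneg hp (neg_nonneg.2 hy), signedPow, signedPow, abs_neg]
    ring
  have h2 : w = (-y) ^ (p - 1) := by linarith
  rw [h2, ← Real.rpow_mul (neg_nonneg.2 hy), mul_one_div_cancel hp1.ne', Real.rpow_one, neg_neg]

section SecondDerivative

variable {T : ℝ} {f f₁ f₂ : ℝ → ℝ}

lemma iteratedDerivWithin_two_eq (hT : 0 < T)
    (hf : ∀ t ∈ Icc 0 T, HasDerivWithinAt f (f₁ t) (Icc 0 T) t)
    (hf₁ : ∀ t ∈ Icc 0 T, HasDerivWithinAt f₁ (f₂ t) (Icc 0 T) t) :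
    EqOn (iteratedDerivWithin 2 f (Icc 0 T)) f₂ (Icc 0 T) := by
  have hud := uniqueDiffOn_Icc hT
  intro t ht
  rw [iteratedDerivWithin_succ, iteratedDerivWithin_one]
  have h1 : EqOn (derivWithin f (Icc 0 T)) f₁ (Icc 0 T) := fun s hs =>
    (hf s hs).derivWithin (hud s hs)
  rw [derivWithin_congr h1 (h1 ht)]
  exact (hf₁ t ht).derivWithin (hud t ht)

lemma contDiffOn_two_of_hasDerivWithinAt (hT : 0 < T)
    (hf : ∀ t ∈ Icc 0 T, HasDerivWithinAt f (f₁ t) (Icc 0 T) t)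
    (hf₁ : ∀ t ∈ Icc 0 T, HasDerivWithinAt f₁ (f₂ t) (Icc 0 T) t)
    (hf₂ : ContinuousOn f₂ (Icc 0 T)) : ContDiffOn ℝ 2 f (Icc 0 T) := by
  have hud := uniqueDiffOn_Icc hT
  have h1 : EqOn (derivWithin f (Icc 0 T)) f₁ (Icc 0 T) := fun s hs =>
    (hf s hs).derivWithin (hud s hs)
  have h2 : EqOn (derivWithin f₁ (Icc 0 T)) f₂ (Icc 0 T) := fun s hs =>
    (hf₁ s hs).derivWithin (hud s hs)
  rw [show (2 : WithTop ℕ∞) = 1 + 1 by norm_num, contDiffOn_succ_iff_derivWithin hud]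
  refine ⟨fun t ht => (hf t ht).differentiableWithinAt, by simp, ContDiffOn.congr ?_ h1⟩
  rw [contDiffOn_one_iff_derivWithin hud]
  exact ⟨fun t ht => (hf₁ t ht).differentiableWithinAt, hf₂.congr h2⟩

lemma ContDiffOn.hasDerivWithinAt_derivWithin_two (hT : 0 < T) (hf : ContDiffOn ℝ 2 f (Icc 0 T)) :
    (∀ t ∈ Icc 0 T, HasDerivWithinAt f (derivWithin f (Icc 0 T) t) (Icc 0 T) t) ∧
    ∀ t ∈ Icc 0 T, HasDerivWithinAt (derivWithin f (Icc 0 T))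
      (iteratedDerivWithin 2 f (Icc 0 T) t) (Icc 0 T) t := by
  have hud := uniqueDiffOn_Icc hT
  rw [show (2 : WithTop ℕ∞) = 1 + 1 by norm_num, contDiffOn_succ_iff_derivWithin hud,
    contDiffOn_one_iff_derivWithin hud] at hf
  refine ⟨fun t ht => (hf.1 t ht).hasDerivWithinAt, fun t ht => ?_⟩
  rw [iteratedDerivWithin_succ, iteratedDerivWithin_one]
  exact (hf.2.2.1 t ht).hasDerivWithinAt

end SecondDerivative

section Conversion

variable {p q lam T : ℝ} {u u₁ w w₁ v : ℝ → ℝ}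

lemma IsPositiveNavierSolution.congr (hT : 0 < T) (h : IsPositiveNavierSolution p q lam T u)
    (huv : EqOn v u (Icc 0 T)) : IsPositiveNavierSolution p q lam T v := by
  have h0 : (0 : ℝ) ∈ Icc 0 T := left_mem_Icc.2 hT.le
  have hTT : T ∈ Icc 0 T := right_mem_Icc.2 hT.le
  have h2 := iteratedDerivWithin_congr (n := 2) huv
  have hflux : EqOn (biharmonicFlux p T v) (biharmonicFlux p T u) (Icc 0 T) := fun t ht => by
    rw [biharmonicFlux, biharmonicFlux, h2 ht]
  exact
    { contDiffOn := h.contDiffOn.congr huv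
      contDiffOn_flux := h.contDiffOn_flux.congr hflux
      equation := fun t ht => by
        rw [iteratedDerivWithin_congr hflux ht, huv ht, h.equation t ht]
      left := by rw [huv h0, h.left]
      right := by rw [huv hTT, h.right]
      left_second := by rw [h2 h0, h.left_second]
      right_second := by rw [h2 hTT, h.right_second]
      pos := fun t ht => by
        rw [huv (Ioo_subset_Icc_self ht)]
        exact h.pos t ht }

/-- Take `w` to be minus the flux: it is strictly concave and zero at both ends, hence positive
inside, so the signed power can be inverted on the negative side. -/
lemma IsPositiveNavierSolution.exists_laneEmdenPair (hp : 1 < p) (hq : 1 < q) (hlam : 0 < lam)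
    (hT : 0 < T) (h : IsPositiveNavierSolution p q lam T u) :
    ∃ u₁ w w₁ : ℝ → ℝ, LaneEmdenPair (1 / (p - 1)) (q - 1) lam T u u₁ w w₁ ∧ w T = 0 := by
  obtain ⟨hu, hu₁⟩ := h.contDiffOn.hasDerivWithinAt_derivWithin_two hT
  obtain ⟨hw, hw₁⟩ := h.contDiffOn_flux.hasDerivWithinAt_derivWithin_two hT
  have h0 : (0 : ℝ) ∈ Icc 0 T := left_mem_Icc.2 hT.le
  have hTT : T ∈ Icc 0 T := right_mem_Icc.2 hT.le
  have hu0 : ∀ t ∈ Icc 0 T, 0 ≤ u t :=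
    LaneEmdenPair.nonneg_of_pos hT h.contDiffOn.continuousOn h.pos
  set ψ := biharmonicFlux p T u with hψ
  have w0 : -ψ 0 = 0 := by simp [hψ, biharmonicFlux, h.left_second, signedPow]
  have wT : -ψ T = 0 := by simp [hψ, biharmonicFlux, h.right_second, signedPow]
  have hψ₂ : ∀ t ∈ Icc 0 T, HasDerivWithinAt (fun t => -derivWithin ψ (Icc 0 T) t)
      (-(lam * u t ^ (q - 1))) (Icc 0 T) t := fun t ht => by
    have := (hw₁ t ht).neg
    rwa [h.equation t ht, signedPow_of_nonneg hq (hu0 t ht)] at this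
  have hwpos : ∀ t ∈ Ioo 0 T, 0 < -ψ t := fun t ht =>
    pos_of_hasDerivWithinAt_neg (w := fun t => -ψ t) (fun s hs => (hw s hs).neg) hψ₂
      (fun s hs => by
        have := h.pos s hs
        rw [neg_lt_zero]
        positivity) w0 wT ht
  have hw0 : ∀ t ∈ Icc 0 T, 0 ≤ -ψ t := LaneEmdenPair.nonneg_of_pos (f := fun t => -ψ t) hT
    h.contDiffOn_flux.continuousOn.neg hwpos
  refine ⟨derivWithin u (Icc 0 T), fun t => -ψ t, fun t => -derivWithin ψ (Icc 0 T) t,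
    ⟨hu, fun t ht => ?_, fun t ht => (hw t ht).neg, hψ₂, h.left, w0, h.pos, hwpos⟩, wT⟩
  rw [← eq_neg_rpow_of_signedPow_eq hp (hw0 t ht)
    (y := iteratedDerivWithin 2 u (Icc 0 T) t) (by rw [neg_neg]; rfl)]
  exact hu₁ t ht

lemma LaneEmdenPair.isPositiveNavierSolution (hp : 1 < p) (hq : 1 < q) (hT : 0 < T)
    (P : LaneEmdenPair (1 / (p - 1)) (q - 1) lam T u u₁ w w₁) (huT : u T = 0) (hwT : w T = 0) :
    IsPositiveNavierSolution p q lam T u := by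
  have hp1 : 0 < 1 / (p - 1) := by
    have : 0 < p - 1 := by linarith
    positivity
  have h0 : (0 : ℝ) ∈ Icc 0 T := left_mem_Icc.2 hT.le
  have hTT : T ∈ Icc 0 T := right_mem_Icc.2 hT.le
  have h2 := iteratedDerivWithin_two_eq hT P.hu P.hu₁
  have hflux : EqOn (biharmonicFlux p T u) (fun t => -w t) (Icc 0 T) := fun t ht => by
    rw [biharmonicFlux, h2 ht, signedPow_neg_rpow hp (P.w_nonneg hT t ht)]
  have hw₂ : ∀ t ∈ Icc 0 T, HasDerivWithinAt (fun t => -w₁ t) (lam * u t ^ (q - 1)) (Icc 0 T) t :=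
    fun t ht => (P.hw₁ t ht).neg.congr_deriv (neg_neg _)
  have hnw : ∀ t ∈ Icc 0 T, HasDerivWithinAt (fun t => -w t) (-w₁ t) (Icc 0 T) t :=
    fun t ht => (P.hw t ht).neg
  exact
    { contDiffOn := contDiffOn_two_of_hasDerivWithinAt hT P.hu P.hu₁
        (P.continuousOn_w.rpow_const fun _ _ => Or.inr hp1.le).neg
      contDiffOn_flux := (contDiffOn_two_of_hasDerivWithinAt hT hnw hw₂
        (continuousOn_const.mul
          (P.continuousOn_u.rpow_const fun _ _ => Or.inr (by linarith)))).congr hflux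
      equation := fun t ht => by
        rw [iteratedDerivWithin_congr hflux ht,
          iteratedDerivWithin_two_eq hT hnw hw₂ ht,
          signedPow_of_nonneg hq (P.u_nonneg hT t ht)]
      left := P.u_zero
      right := huT
      left_second := by
        simp only [h2 h0, P.w_zero, Real.zero_rpow hp1.ne', neg_zero]
      right_second := by
        simp only [h2 hTT, hwT, Real.zero_rpow hp1.ne', neg_zero]
      pos := P.u_pos }

/-- Positive solutions for two parameters are proportional, and the factor links the parameters. -/
theorem IsPositiveNavierSolution.exists_eqOn_mul {lam' : ℝ} (hp : 1 < p) (hq : 1 < q)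
    (hlam : 0 < lam) (hlam' : 0 < lam') (hT : 0 < T) (hu : IsPositiveNavierSolution p q lam T u)
    (hv : IsPositiveNavierSolution p q lam' T v) :
    ∃ A > 0, EqOn u (fun t => A * v t) (Icc 0 T) ∧ A ^ (p - 1) * lam' = lam * A ^ (q - 1) := by
  obtain ⟨u₁, w, w₁, P, hwT⟩ := hu.exists_laneEmdenPair hp hq hlam hT
  obtain ⟨v₁, z, z₁, Q, hzT⟩ := hv.exists_laneEmdenPair hp hq hlam' hT
  have hp1 : 0 < p - 1 := by linarith
  have := P.exists_eqOn_mul (by positivity) (by linarith) hlam hlam' hT Q hu.right hwT hv.right hzT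
  rwa [one_div_one_div] at this

/-- Multiples of a positive solution are positive solutions for the linked parameter. -/
theorem IsPositiveNavierSolution.const_mul {lam' A : ℝ} (hp : 1 < p) (hq : 1 < q)
    (hlam : 0 < lam) (hT : 0 < T) (hA : 0 < A) (hu : IsPositiveNavierSolution p q lam T u)
    (h : A ^ (p - 1) * lam = lam' * A ^ (q - 1)) :
    IsPositiveNavierSolution p q lam' T (fun t => A * u t) := by
  obtain ⟨u₁, w, w₁, P, hwT⟩ := hu.exists_laneEmdenPair hp hq hlam hT
  have hp1 : 0 < p - 1 := by linarith
  -- With `μ = 1`, the first scaling condition `A = B^(1/(p-1))` dictates `B`.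
  have P' := P.scale hT hA (B := A ^ (p - 1)) (lam' := lam') (by positivity) one_pos
    (by rw [← Real.rpow_mul hA.le, mul_one_div_cancel hp1.ne', Real.rpow_one]; ring)
    (by rw [← h]; ring)
  simp only [div_one, one_mul] at P'
  exact P'.isPositiveNavierSolution hp hq hT (by simp [hu.right]) (by simp [hwT])

end Conversion

/-! ### Conclusion from the relation between factor and parameters. -/

theorem mainTheorem1 (p q t₀ : ℝ) (hp : 1 < p) (hq : 1 < q) (ht₀ : 0 < t₀) :
    (p ≠ q → ∀ lam : ℝ, 0 < lam →
      ∃ u : ℝ → ℝ, IsPositiveNavierSolution p q lam t₀ u ∧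
        ∀ v : ℝ → ℝ, IsPositiveNavierSolution p q lam t₀ v → EqOn v u (Icc 0 t₀)) ∧
    (p = q →
      (∃! lam : ℝ, 0 < lam ∧ ∃ u : ℝ → ℝ, IsPositiveNavierSolution p q lam t₀ u) ∧
      ∀ lam : ℝ, 0 < lam → ∀ u : ℝ → ℝ, IsPositiveNavierSolution p q lam t₀ u →
        ∀ v : ℝ → ℝ, IsPositiveNavierSolution p q lam t₀ v ↔
          ∃ c : ℝ, 0 < c ∧ EqOn v (fun t => c * u t) (Icc 0 t₀)) := by
  obtain ⟨lam₀, v₀, v₁, z₀, z₁, hlam₀, P, hv, hz⟩ := LaneEmdenPair.exists_dirichlet hp hq ht₀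
  have hv₀ := P.isPositiveNavierSolution hp hq ht₀ hv hz
  refine ⟨fun hpq lam hlam => ?_, fun hpq => ⟨⟨lam₀, ⟨hlam₀, v₀, hv₀⟩, ?_⟩, ?_⟩⟩
  · have hpq' : p - q ≠ 0 := sub_ne_zero.2 hpq
    -- The factor carrying `lam₀` to `lam` solves `A ^ (p - q) = lam / lam₀`, which is possible
    -- because `p ≠ q`.
    set A := (lam / lam₀) ^ (1 / (p - q)) with hAdef
    have hA : 0 < A := by positivity
    have hApow : A ^ (p - 1) * lam₀ = lam * A ^ (q - 1) := by
      have h : A ^ (p - q) = lam / lam₀ := by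
        rw [hAdef, ← Real.rpow_mul (by positivity), one_div_mul_cancel hpq', Real.rpow_one]
      rw [show p - 1 = p - q + (q - 1) by ring, Real.rpow_add hA, h]
      field_simp
    have hu := hv₀.const_mul hp hq hlam₀ ht₀ hA hApow
    refine ⟨_, hu, fun v hv => ?_⟩
    obtain ⟨B, hB, heq, hBpow⟩ := hv.exists_eqOn_mul hp hq hlam hlam ht₀ hu
    have hB1 : B = 1 := by
      have h : B ^ (p - q) = 1 := by
        rw [show p - 1 = p - q + (q - 1) by ring, Real.rpow_add hB] at hBpow
        have : 0 < lam * B ^ (q - 1) := by positivity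
        exact mul_right_cancel₀ this.ne' (by linarith)
      rw [← Real.rpow_rpow_inv hB.le hpq', h, Real.one_rpow]
    simpa only [hB1, one_mul] using heq
  · rintro lam ⟨hlam, u, hu⟩
    obtain ⟨B, hB, -, hBpow⟩ := hu.exists_eqOn_mul hp hq hlam hlam₀ ht₀ hv₀
    -- For `p = q` both powers of `B` coincide and cancel, leaving equality of the parameters.
    rw [hpq, mul_comm] at hBpow
    exact (mul_right_cancel₀ (by positivity) hBpow).symm
  · refine fun lam hlam u hu v => ⟨fun hv => ?_, fun ⟨c, hc, heq⟩ => ?_⟩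
    · obtain ⟨B, hB, heq, -⟩ := hv.exists_eqOn_mul hp hq hlam hlam ht₀ hu
      exact ⟨B, hB, heq⟩
    · exact (hu.const_mul hp hq hlam ht₀ hc (by rw [hpq, mul_comm])).congr ht₀ heq
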